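/- **Setting.** Let $\mathcal A$ be a finite action set and $\mathcal Y$ an outcome space (a measurable space, e.g. a Euclidean space or a compact subset of one) with a reference measure $\nu$. Given action $a$, outcomes are drawn independently over time from $Q^*(\cdot|a)$, which has a positive density $q^*(\cdot|a)$ with respect to $\nu$; the flow payoff is $u(a,y)$, with $u(a,\cdot)\in L^1(Q^*(\cdot|a))$. Fix a discount factor $\delta\in[0,1)$ and a switching threshold $\alpha>1$. A *model* $\theta$ is a finite nonempty set $\Omega^\theta\subset\mathbb R^d$ together with positive densities $q^\theta(\cdot|a,\omega)$ with respect to $\nu$ of probability measures $Q^\theta(\cdot|a,\omega)$ such that, for all $a\in\mathcal A$ and $\omega\in\Omega^\theta$, $u(a,\cdot)\in L^1(Q^\theta(\cdot|a,\omega))$ and $|\ln (q^*(\cdot|a)/q^\theta(\cdot|a,\omega))|\le g_a$ holds $Q^*(\cdot|a)$-a.s. for some $g_a\in L^2(Q^*(\cdot|a))$. Let $q(\cdot|a,\omega)$, $\omega\in\Omega^q\subseteq\mathbb R^d$, be a parametric profile of densities, each satisfying these same conditions; $\Theta^q$ is the set of models with $\Omega^\theta\subseteq\Omega^q$ and $q^\theta(\cdot|a,\omega)=q(\cdot|a,\omega)$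 for all $a$ and all $\omega\in\Omega^\theta$. An *optimal policy* $a^\theta:\Delta\Omega^\theta\to\mathcal A$ is a measurable selection of maximizers in the Bellman equation $$U^\theta(\pi)=\max_a\sum_{\omega}\pi(\omega)\int[u(a,y)+\delta U^\theta(B^\theta(a,y,\pi))]\,q^\theta(y|a,\omega)\,\nu(dy),$$ where $B^\theta$ is Bayes' rule and $U^\theta$ is the bounded measurable solution. A *dogmatic modeler* with model $\theta$, full-support prior $\pi_0^\theta$ and policy $a^\theta$ plays $a_t=a^\theta(\pi_t^\theta)$, where $\pi^\theta_t$ is her posterior. Her action frequency is $\sigma_t(a)=\frac1t\#\{\tau<t:a_\tau=a\}$. A *switcher* with initial model $\theta$ and competing model $\theta^c$, each with a prior and a policy, computes the likelihoods $l_t^{\vartheta}=\sum_{\omega\in\Omega^\vartheta}\pi_0^{\vartheta}(\omega)\prod_{\tau<t}q^{\vartheta}(y_\tau|a_\tau,\omega)$ for $\vartheta\in\{\theta,\theta^c\}$. Her model choice is $m_0=\theta$, and in each period $t\ge1$ she switches from $m_{t-1}$ to the other model $\vartheta$ if and only if $l_t^{\vartheta}/l_t^{m_{t-1}}>\alpha$.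 She plays $a_t=a^{m_t}(\pi_t^{m_t})$, where $\pi_t^{m_t}$ is the posterior of model $m_t$ given the full history. Model $\theta$ *persists* against $\theta^c$ (at given priors and policies) if, with positive probability, $m_t=\theta$ for all large $t$. Model $\theta\in\Theta^q$ is *$q$-constrained locally robust* if there are $\epsilon>0$, a full-support prior $\pi_0^\theta$ and an optimal policy $a^\theta$ at which $\theta$ persists against every $\theta^c\in\Theta^q$ whose parameter set is within Hausdorff distance $\epsilon$ of $\Omega^\theta$, at every full-support prior $\pi_0^{\theta^c}$ within Prokhorov distance $\epsilon$ of $\pi_0^\theta$ and every optimal policy $a^{\theta^c}$. For $\sigma\in\Delta\mathcal A$, let $\Omega^\theta(\sigma)=\arg\min_{\omega\in\Omega^\theta}\sum_a\sigma(a)\int q^*(y|a)\ln\frac{q^*(y|a)}{q^\theta(y|a,\omega)}\,\nu(dy)$. The mixed action $\sigma$ is a *Berk–Nash equilibrium* under $\theta$ if some belief $\pi$ carried by $\Omega^\theta(\sigma)$ makes every action in the support of $\sigma$ a maximizer of $a\mapsto\sum_\omega\pi(\omega)\int u(a,y)q^\theta(y|a,\omega)\,\nu(dy)$. Model $\theta$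 is *locally KL-minimizing at $\sigma$ with respect to $\Omega^q$* if there is $\epsilon>0$ such that for all $\omega\in\Omega^\theta(\sigma)$ and all $\omega'\in\Omega^q$ at distance less than $\epsilon$ from $\Omega^\theta(\sigma)$, $$\sum_a\sigma(a)\,\mathbb E_{y\sim Q^*(\cdot|a)}\ln\frac{q(y|a,\omega')}{q(y|a,\omega)}\le 0 .$$ **Theorem 5.** Let $\theta\in\Theta^q$. Suppose that for every full-support prior and every optimal policy, the action frequency of the dogmatic modeler with model $\theta$ almost surely converges to a Berk–Nash equilibrium under $\theta$ (which may depend on the path). If $\theta$ is $q$-constrained locally robust, then there is a Berk–Nash equilibrium $\sigma$ under $\theta$ at which $\theta$ is locally KL-minimizing with respect to $\Omega^q$. -/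

import Mathlib

open MeasureTheory Filter Topology

namespace Misspec

noncomputable section

/-- The objective environment: a reference measure `ν` on outcomes, the true densities
`qStar a` with respect to `ν`, and the flow payoff `u`. -/
structure Environment (A Y : Type*) [MeasurableSpace Y] where
  /-- the common reference measure -/
  ν : Measure Y
  /-- density of the true outcome distribution, given the action -/
  qStar : A → Y → ℝ
  /-- flow payoff -/
  u : A → Y → ℝ
  measurable_qStar : ∀ a, Measurable (qStar a)
  qStar_pos : ∀ a y, 0 < qStar a y
  lintegral_qStar : ∀ a, ∫⁻ y, ENNReal.ofReal (qStar a y) ∂ν = 1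
  integrable_u : ∀ a, Integrable (u a) (ν.withDensity fun y => ENNReal.ofReal (qStar a y))

namespace Environment

variable {A Y : Type*} [MeasurableSpace Y] (E : Environment A Y)

/-- The true outcome distribution `Q*(· | a)`. -/
def trueLaw (a : A) : Measure Y :=
  E.ν.withDensity fun y => ENNReal.ofReal (E.qStar a y)

instance isProbabilityMeasure_trueLaw (a : A) : IsProbabilityMeasure (E.trueLaw a) :=
  ⟨by simp [trueLaw, E.lintegral_qStar a]⟩

/-- The probability space of outcomes: `x t a` is the outcome that is observed in period `t` if
action `a` is taken in that period; all of these are drawn independently from `Q*`. -/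
def pathMeasure [Fintype A] : Measure (ℕ → A → Y) :=
  Measure.infinitePi fun _ : ℕ => Measure.pi E.trueLaw

/-- Standing assumption on the outcome densities `f a = q(· | a, ω)` that a single parameter
`ω` predicts: positive densities of probability measures, integrable payoffs, and log-likelihood
ratios to the truth that are dominated by a square-integrable function. -/
structure Admissible (f : A → Y → ℝ) : Prop where
  measurable : ∀ a, Measurable (f a)
  pos : ∀ a y, 0 < f a y
  lintegral_eq_one : ∀ a, ∫⁻ y, ENNReal.ofReal (f a y) ∂E.ν = 1
  integrable_u : ∀ a, Integrable (E.u a) (E.ν.withDensity fun y => ENNReal.ofReal (f a y))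
  log_ratio_bound : ∀ a, ∃ g : Y → ℝ, MemLp g 2 (E.trueLaw a) ∧
    ∀ᵐ y ∂E.trueLaw a, |Real.log (E.qStar a y / f a y)| ≤ g y

/-- Kullback-Leibler divergence `∫ p ln (p / p') dν` of the density `p` from `p'`. -/
def klDiv (p p' : Y → ℝ) : ℝ :=
  ∫ y, p y * Real.log (p y / p' y) ∂E.ν

end Environment

/-- A subjective model: a finite nonempty parameter set in a Euclidean space and, for each of its
parameters, an admissible profile of action-dependent outcome densities. (Only the values of
`dens` at parameters in `params` matter.) -/
structure Model {A Y : Type*} [MeasurableSpace Y] (E : Environment A Y) (d : ℕ) where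
  params : Finset (EuclideanSpace ℝ (Fin d))
  nonempty : params.Nonempty
  /-- `dens a ω y` is `q(y | a, ω)` -/
  dens : A → EuclideanSpace ℝ (Fin d) → Y → ℝ
  admissible : ∀ ω ∈ params, E.Admissible fun a => dens a ω

namespace Model

variable {A Y : Type*} [MeasurableSpace Y] {E : Environment A Y} {d : ℕ} (θ : Model E d)

/-- Beliefs: probability vectors on the parameter set. -/
abbrev Belief : Type := stdSimplex ℝ θ.params

lemma predictive_pos (a : A) (y : Y) (π : θ.Belief) :
    0 < ∑ ω : θ.params, π.1 ω * θ.dens a ω y := by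
  have hd : ∀ ω : θ.params, 0 < θ.dens a ω y := fun ω => (θ.admissible ω.1 ω.2).pos a y
  have hn : ∀ ω : θ.params, 0 ≤ π.1 ω * θ.dens a ω y :=
    fun ω => mul_nonneg (π.2.1 ω) (hd ω).le
  refine lt_of_le_of_ne (Finset.sum_nonneg fun ω _ => hn ω) fun h => ?_
  have h0 := (Finset.sum_eq_zero_iff_of_nonneg fun ω _ => hn ω).1 h.symm
  have hz : ∀ ω : θ.params, π.1 ω = 0 := fun ω =>
    (mul_eq_zero.1 (h0 ω (Finset.mem_univ ω))).resolve_right (hd ω).ne'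
  have h1 := π.2.2
  simp [hz] at h1

/-- The Bayesian operator. -/
def bayes (a : A) (y : Y) (π : θ.Belief) : θ.Belief :=
  ⟨fun ω => π.1 ω * θ.dens a ω y / ∑ ω' : θ.params, π.1 ω' * θ.dens a ω' y,
    fun ω => div_nonneg (mul_nonneg (π.2.1 ω) ((θ.admissible ω.1 ω.2).pos a y).le)
      (θ.predictive_pos a y π).le,
    by rw [← Finset.sum_div, div_self (θ.predictive_pos a y π).ne']⟩

def FullSupport (π : θ.Belief) : Prop := ∀ ω, 0 < π.1 ω

/-- Expected value of playing `a` at belief `π` when continuation values are given by `U`. -/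
def qValue (δ : ℝ) (U : θ.Belief → ℝ) (π : θ.Belief) (a : A) : ℝ :=
  ∑ ω : θ.params, π.1 ω * ∫ y, (E.u a y + δ * U (θ.bayes a y π)) * θ.dens a ω y ∂E.ν

/-- `U` is the value function: the bounded measurable solution of the Bellman equation
`U(π) = max_a ...`. -/
structure IsValueFunction (δ : ℝ) (U : θ.Belief → ℝ) : Prop where
  measurable : Measurable U
  bounded : ∃ C, ∀ π, |U π| ≤ C
  bellman : ∀ π, IsGreatest (Set.range (θ.qValue δ U π)) (U π)

/-- Pure optimal policies: (measurable) selections from the solution correspondence of the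
dynamic programming problem. -/
def OptimalPolicy [MeasurableSpace A] (δ : ℝ) (pol : θ.Belief → A) : Prop :=
  Measurable pol ∧ ∃ U, θ.IsValueFunction δ U ∧
    ∀ π a, θ.qValue δ U π a ≤ θ.qValue δ U π (pol π)

/-- Expected flow payoff of `a` at belief `π`. -/
def myopicValue (π : θ.Belief) (a : A) : ℝ :=
  ∑ ω : θ.params, π.1 ω * ∫ y, E.u a y * θ.dens a ω y ∂E.ν

/-- Myopically optimal actions (the solutions of the problem with discount factor zero). -/
def myopicOptimal (π : θ.Belief) : Set A :=
  {a | ∀ b, θ.myopicValue π b ≤ θ.myopicValue π a}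

/-- The `σ`-weighted KL divergence of the prediction of `ω` from the truth. -/
def weightedKL [Fintype A] (σ : A → ℝ) (ω : EuclideanSpace ℝ (Fin d)) : ℝ :=
  ∑ a, σ a * E.klDiv (E.qStar a) (θ.dens a ω)

/-- The KL minimizers at `σ` under `θ`. -/
def klMinimizers [Fintype A] (σ : A → ℝ) : Set (EuclideanSpace ℝ (Fin d)) :=
  {ω | ω ∈ θ.params ∧ ∀ ω' ∈ θ.params, θ.weightedKL σ ω ≤ θ.weightedKL σ ω'}

/-- Berk-Nash equilibrium: a mixed action whose support is myopically optimal at some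
belief that is carried by the KL minimizers. -/
def IsBerkNash [Fintype A] (σ : A → ℝ) : Prop :=
  σ ∈ stdSimplex ℝ A ∧ ∃ π : θ.Belief,
    (∀ ω : θ.params, π.1 ω ≠ 0 → (ω : EuclideanSpace ℝ (Fin d)) ∈ θ.klMinimizers σ) ∧
    ∀ a, σ a ≠ 0 → a ∈ θ.myopicOptimal π

/-- Likelihood of a history under the prior `π₀`. -/
def likelihood (π₀ : θ.Belief) (h : List (A × Y)) : ℝ :=
  ∑ ω : θ.params, π₀.1 ω * (h.map fun p => θ.dens p.1 ω p.2).prod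

/-- Belief after a history, by repeated Bayesian updating. Histories are lists of pairs (action,
outcome), most recent pair first. -/
def posterior (π₀ : θ.Belief) : List (A × Y) → θ.Belief
  | [] => π₀
  | p :: h => θ.bayes p.1 p.2 (posterior π₀ h)

/-- A belief, as a probability measure on the ambient Euclidean space. -/
def beliefMeasure (π : θ.Belief) : Measure (EuclideanSpace ℝ (Fin d)) :=
  ∑ ω : θ.params, ENNReal.ofReal (π.1 ω) • Measure.dirac (ω : EuclideanSpace ℝ (Fin d))

end Model

section Play

variable {A Y : Type*}

/-- The history at the start of period `t`, most recent pair first, when actions are chosen by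
`rule` and outcomes are read off the path `x`. -/
def history (rule : List (A × Y) → A) (x : ℕ → A → Y) : ℕ → List (A × Y)
  | 0 => []
  | t + 1 => (rule (history rule x t), x t (rule (history rule x t))) :: history rule x t

/-- Share of the periods `0, ..., t - 1` in which `a` is played. -/
def actionFreq [DecidableEq A] (rule : List (A × Y) → A) (x : ℕ → A → Y) (t : ℕ) (a : A) : ℝ :=
  ((Finset.range t).filter fun s => rule (history rule x s) = a).card / (t : ℝ)

end Play

/-- A dogmatic modeler: a model with a prior and a policy. A switcher is described by two of
them, one for the initial and one for the competing model. -/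
structure Modeler {A Y : Type*} [MeasurableSpace Y] (E : Environment A Y) (d : ℕ) where
  model : Model E d
  prior : model.Belief
  policy : model.Belief → A

namespace Modeler

variable {A Y : Type*} [MeasurableSpace Y] {E : Environment A Y} {d : ℕ}

def likelihood (M : Modeler E d) (h : List (A × Y)) : ℝ :=
  M.model.likelihood M.prior h

/-- The action that the modeler chooses after a history. -/
def rule (M : Modeler E d) (h : List (A × Y)) : A :=
  M.policy (M.model.posterior M.prior h)

/-- The two models of a switcher: `false` is the initial model, `true` the competing model. -/
def pick (M Mc : Modeler E d) (b : Bool) : Modeler E d := if b then Mc else M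

/-- Model choice of the switcher after a history. With two models the Bayes factor of the current
model is `1 < α`, so a switch is triggered exactly if the Bayes factor of the other model
exceeds `α`. -/
def modelChoice (α : ℝ) (M Mc : Modeler E d) : List (A × Y) → Bool
  | [] => false
  | p :: h =>
    if α < (pick M Mc (!modelChoice α M Mc h)).likelihood (p :: h) /
        (pick M Mc (modelChoice α M Mc h)).likelihood (p :: h)
    then !modelChoice α M Mc h else modelChoice α M Mc h

/-- The action that the switcher chooses after a history: that of the adopted model, at the
posterior computed from the full history. -/
def switcherRule (α : ℝ) (M Mc : Modeler E d) (h : List (A × Y)) : A :=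
  (pick M Mc (modelChoice α M Mc h)).rule h

/-- The initial model persists against the competing one: with positive probability, the model
choice converges to the initial model, that is, equals it from some period on. -/
def Persists [Fintype A] (α : ℝ) (M Mc : Modeler E d) : Prop :=
  0 < E.pathMeasure {x | ∀ᶠ t in atTop,
    modelChoice α M Mc (history (switcherRule α M Mc) x t) = false}

end Modeler

/-- The action frequency of the dogmatic modeler almost surely converges to a Berk-Nash
equilibrium (which may depend on the path), under every full-support prior and every optimal
policy. -/
def Model.DogmaticConvergence {A Y : Type*} [Fintype A] [DecidableEq A] [MeasurableSpace A]
    [MeasurableSpace Y] {E : Environment A Y} {d : ℕ} (δ : ℝ) (θ : Model E d) : Prop :=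
  ∀ π₀ pol, θ.FullSupport π₀ → θ.OptimalPolicy δ pol →
    ∀ᵐ x ∂E.pathMeasure, ∃ σ, θ.IsBerkNash σ ∧
      Tendsto (actionFreq (Modeler.rule ⟨θ, π₀, pol⟩) x) atTop (𝓝 σ)

/-- A parametric profile `q` of action-dependent outcome densities over an arbitrary subset `Ωq`
of a Euclidean space. -/
structure Family {A Y : Type*} [MeasurableSpace Y] (E : Environment A Y) (d : ℕ) where
  Ωq : Set (EuclideanSpace ℝ (Fin d))
  /-- `dens a ω y` is `q(y | a, ω)` -/
  dens : A → EuclideanSpace ℝ (Fin d) → Y → ℝ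
  admissible : ∀ ω ∈ Ωq, E.Admissible fun a => dens a ω

namespace Family

variable {A Y : Type*} [MeasurableSpace Y] {E : Environment A Y} {d : ℕ} (q : Family E d)

/-- The `q`-family of models. -/
def models : Set (Model E d) :=
  {θ | ↑θ.params ⊆ q.Ωq ∧ ∀ ω ∈ θ.params, ∀ a, θ.dens a ω = q.dens a ω}

/-- The `ε`-neighborhood of `θ` in the `q`-family. -/
def nhd (ε : ℝ) (θ : Model E d) : Set (Model E d) :=
  {θ' | θ' ∈ q.models ∧
    Metric.hausdorffDist (θ.params : Set (EuclideanSpace ℝ (Fin d))) θ'.params ≤ ε}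

/-- `q`-constrained local robustness, with switching threshold `α` and discount factor `δ`. -/
def LocallyRobust [Fintype A] [MeasurableSpace A] (δ α : ℝ) (θ : Model E d) : Prop :=
  ∃ ε > 0, ∃ π₀ pol, θ.FullSupport π₀ ∧ θ.OptimalPolicy δ pol ∧
    ∀ θc ∈ q.nhd ε θ, ∀ πc polc, θc.FullSupport πc → θc.OptimalPolicy δ polc →
      levyProkhorovDist (θ.beliefMeasure π₀) (θc.beliefMeasure πc) ≤ ε →
      Modeler.Persists α ⟨θ, π₀, pol⟩ ⟨θc, πc, polc⟩

/-- `θ` is locally KL-minimizing at `σ` with respect to `Ωq`. -/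
def LocallyKLMinimizing [Fintype A] (θ : Model E d) (σ : A → ℝ) : Prop :=
  ∃ ε > 0, ∀ ω ∈ θ.klMinimizers σ, ∀ ω' ∈ q.Ωq ∩ Metric.thickening ε (θ.klMinimizers σ),
    ∑ a, σ a * ∫ y, Real.log (q.dens a ω' y / q.dens a ω y) ∂E.trueLaw a ≤ 0

end Family

end

end Misspec

namespace Misspec

noncomputable section

/-- Kronecker's lemma with weights `n + 1`. -/
lemma tendsto_average_of_tendsto_sum_div {u : ℕ → ℝ} {l : ℝ}
    (h : Tendsto (fun n => ∑ s ∈ Finset.range n, u s / (s + 1 : ℝ)) atTop (𝓝 l)) :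
    Tendsto (fun n : ℕ => (n : ℝ)⁻¹ * ∑ s ∈ Finset.range n, u s) atTop (𝓝 0) := by
  set S : ℕ → ℝ := fun n => ∑ s ∈ Finset.range n, u s / (s + 1 : ℝ) with hS
  have key : ∀ n : ℕ, ∑ s ∈ Finset.range n, u s = n * S n - ∑ s ∈ Finset.range n, S s := by
    intro n
    induction n with
    | zero => simp
    | succ n ih =>
      have h1 : S (n + 1) = S n + u n / (n + 1 : ℝ) := Finset.sum_range_succ _ _
      have h2 : (n + 1 : ℝ) ≠ 0 := by positivity
      rw [Finset.sum_range_succ, ih, Finset.sum_range_succ, h1]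
      push_cast
      field_simp
      ring
  have h0 : Tendsto (fun n : ℕ => S n - (n : ℝ)⁻¹ * ∑ s ∈ Finset.range n, S s) atTop
      (𝓝 (l - l)) := h.sub h.cesaro
  rw [sub_self] at h0
  refine h0.congr' ?_
  filter_upwards [eventually_gt_atTop 0] with n hn
  have : (n : ℝ) ≠ 0 := by exact_mod_cast hn.ne'
  rw [key, mul_sub, inv_mul_cancel_left₀ this]

section ProductSpace

variable {Z : Type*} [mZ : MeasurableSpace Z]

/-- The coordinates before time `t`. -/
def pastFiltration (Z : Type*) [mZ : MeasurableSpace Z] :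
    Filtration ℕ (inferInstance : MeasurableSpace (ℕ → Z)) where
  seq t := ⨆ j ∈ {j | j < t}, mZ.comap fun x : ℕ → Z => x j
  mono' _ _ hst := biSup_mono fun _ hj => lt_of_lt_of_le hj hst
  le' _ := iSup₂_le fun j _ => (measurable_pi_apply j).comap_le

lemma measurable_coord_pastFiltration {s t : ℕ} (h : s < t) :
    Measurable[pastFiltration Z t] fun x : ℕ → Z => x s := by
  intro B hB
  exact le_iSup₂_of_le (f := fun j (_ : j ∈ {j | j < t}) => mZ.comap fun x : ℕ → Z => x j)
    s h le_rfl _ ⟨B, hB, rfl⟩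

variable (Q : Measure Z) [IsProbabilityMeasure Q]

lemma indep_coord_pastFiltration (t : ℕ) :
    ProbabilityTheory.Indep (mZ.comap fun x : ℕ → Z => x t) (pastFiltration Z t)
      (Measure.infinitePi fun _ : ℕ => Q) := by
  have hI : ProbabilityTheory.iIndepFun (fun (i : ℕ) (x : ℕ → Z) => x i)
      (Measure.infinitePi fun _ : ℕ => Q) :=
    ProbabilityTheory.iIndepFun_infinitePi (X := fun _ z => z) (fun _ => measurable_id)
  have := ProbabilityTheory.indep_iSup_of_disjoint
    (fun k : ℕ => (measurable_pi_apply (X := fun _ => Z) k).comap_le) hI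
    (S := {t}) (T := {j | j < t}) (by simp)
  simpa [pastFiltration] using this

variable {Q}

section Average

variable {c : ℕ → (ℕ → Z) → ℝ} {h : Z → ℝ}

lemma condExp_mul_coord_eq_zero (t : ℕ) {b : (ℕ → Z) → ℝ}
    (hb : StronglyMeasurable[pastFiltration Z t] b)
    (hh : Integrable h Q) (hm : Measurable h) (h0 : ∫ z, h z ∂Q = 0)
    (hint : Integrable (fun x : ℕ → Z => b x * h (x t)) (Measure.infinitePi fun _ : ℕ => Q)) :
    (Measure.infinitePi fun _ : ℕ => Q)[fun x => b x * h (x t)|pastFiltration Z t]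
      =ᵐ[Measure.infinitePi fun _ : ℕ => Q] 0 := by
  set P := Measure.infinitePi fun _ : ℕ => Q
  have hmp : MeasurePreserving (fun x : ℕ → Z => x t) P Q :=
    measurePreserving_eval_infinitePi (fun _ : ℕ => Q) t
  have hi : Integrable (fun x : ℕ → Z => h (x t)) P := hmp.integrable_comp_of_integrable hh
  have h1 := condExp_mul_of_stronglyMeasurable_left hb hint hi
  have h2 : P[fun x => h (x t)|pastFiltration Z t] =ᵐ[P] fun _ => ∫ x, h (x t) ∂P :=
    condExp_indep_eq (measurable_pi_apply t).comap_le ((pastFiltration Z).le t)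
      ((hm.comp (comap_measurable fun x : ℕ → Z => x t)).stronglyMeasurable)
      (indep_coord_pastFiltration Q t)
  have h3 : ∫ x, h (x t) ∂P = 0 := by
    rw [← h0, ← hmp.map_eq, integral_map hmp.aemeasurable]
    rw [hmp.map_eq]; exact hh.1
  filter_upwards [h1, h2] with x hx1 hx2
  have hx1' : (P[fun x => b x * h (x t)|pastFiltration Z t]) x
      = b x * (P[fun x => h (x t)|pastFiltration Z t]) x := hx1
  rw [hx1', hx2, h3]; simp

/-- Strong law of large numbers for i.i.d. square integrable centred variables, weighted by
bounded predictable coefficients. -/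
theorem ae_tendsto_average_predictable
    (hc : ∀ t, StronglyMeasurable[pastFiltration Z t] (c t)) (hc1 : ∀ t x, |c t x| ≤ 1)
    (hm : Measurable h) (h2 : MemLp h 2 Q) (h0 : ∫ z, h z ∂Q = 0) :
    ∀ᵐ x ∂(Measure.infinitePi fun _ : ℕ => Q),
      Tendsto (fun n : ℕ => (n : ℝ)⁻¹ * ∑ s ∈ Finset.range n, c s x * h (x s)) atTop (𝓝 0) := by
  set P := Measure.infinitePi fun _ : ℕ => Q
  have hh : Integrable h Q := h2.integrable (by norm_num)
  have hmp : ∀ t, MeasurePreserving (fun x : ℕ → Z => x t) P Q :=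
    fun t => measurePreserving_eval_infinitePi (fun _ : ℕ => Q) t
  set ξ : ℕ → (ℕ → Z) → ℝ := fun s x => c s x / (s + 1) * h (x s) with hξ
  set M : ℕ → (ℕ → Z) → ℝ := fun n x => ∑ s ∈ Finset.range n, ξ s x with hM
  have hbd : ∀ s x, |c s x / (s + 1)| ≤ 1 / (s + 1) := by
    intro s x
    have : (0 : ℝ) < s + 1 := by positivity
    rw [abs_div, abs_of_pos this]
    gcongr
    exact hc1 s x
  have hbs : ∀ s, StronglyMeasurable[pastFiltration Z s] fun x => c s x / (s + 1 : ℝ) := by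
    intro s
    have := (hc s).const_smul (s + 1 : ℝ)⁻¹
    convert this using 2 with x
    simp [div_eq_inv_mul]
  have hξle : ∀ s x, |ξ s x| ≤ 1 / (s + 1) * |h (x s)| := by
    intro s x
    rw [hξ, abs_mul]
    exact mul_le_mul_of_nonneg_right (hbd s x) (abs_nonneg _)
  have hξad : ∀ s, StronglyMeasurable[pastFiltration Z (s + 1)] (ξ s) := by
    intro s
    exact ((hbs s).mono ((pastFiltration Z).mono s.le_succ)).mul
      (hm.comp (measurable_coord_pastFiltration s.lt_succ_self)).stronglyMeasurable
  have hhs : ∀ s, MemLp (fun x : ℕ → Z => h (x s)) 2 P := fun s =>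
    h2.comp_measurePreserving (hmp s)
  have hξ2 : ∀ s, MemLp (ξ s) 2 P := by
    intro s
    refine ((hhs s).const_mul (1 / (s + 1 : ℝ))).mono
      ((hξad s).mono ((pastFiltration Z).le _)).aestronglyMeasurable ?_
    refine ae_of_all _ fun x => ?_
    have : (0 : ℝ) ≤ 1 / (s + 1) := by positivity
    refine (hξle s x).trans_eq ?_
    rw [Real.norm_eq_abs, abs_mul, abs_of_nonneg this]
  have hMad : StronglyAdapted (pastFiltration Z) M := by
    intro n
    exact Finset.stronglyMeasurable_fun_sum _ fun s hs =>
      (hξad s).mono ((pastFiltration Z).mono (Finset.mem_range.1 hs))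
  have hM2 : ∀ n, MemLp (M n) 2 P := fun n => memLp_finsetSum _ fun s _ => hξ2 s
  have hξ0 : ∀ s, P[ξ s|pastFiltration Z s] =ᵐ[P] 0 := fun s =>
    condExp_mul_coord_eq_zero s (hbs s) hh hm h0 ((hξ2 s).integrable (by norm_num))
  have hMart : Martingale M (pastFiltration Z) P := by
    refine martingale_of_condExp_sub_eq_zero_nat hMad
      (fun n => (hM2 n).integrable (by norm_num)) fun n => ?_
    have : M (n + 1) - M n = ξ n := by
      ext x; simp [hM, Finset.sum_range_succ]
    rw [this]; exact hξ0 n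
  have hsq : ∀ n, ∫ x, M n x ^ 2 ∂P ≤
      ∑ s ∈ Finset.range n, (1 / (s + 1 : ℝ)) ^ 2 * ∫ z, h z ^ 2 ∂Q := by
    intro n
    induction n with
    | zero => simp [hM]
    | succ n ih =>
      have hcross : Integrable (fun x => M n x * ξ n x) P := (hM2 n).integrable_mul (hξ2 n)
      have hx0 : ∫ x, M n x * ξ n x ∂P = 0 := by
        have e : (fun x => M n x * ξ n x) = fun x => (M n x * (c n x / (n + 1))) * h (x n) := by
          ext x; simp only [hξ]; ring
        have h1 := condExp_mul_coord_eq_zero (b := fun x => M n x * (c n x / (n + 1))) n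
          ((hMad n).mul (hbs n)) hh hm h0 (by simpa only [e] using hcross)
        rw [e, ← integral_condExp ((pastFiltration Z).le n), integral_congr_ae h1]
        simp
      have hM2i : Integrable (fun x => M n x ^ 2) P := (hM2 n).integrable_sq
      have hξ2i : Integrable (fun x => ξ n x ^ 2) P := (hξ2 n).integrable_sq
      have e1 : ∫ x, M (n + 1) x ^ 2 ∂P = ∫ x, M n x ^ 2 ∂P + ∫ x, ξ n x ^ 2 ∂P := by
        have : ∀ x, M (n + 1) x ^ 2 = M n x ^ 2 + ξ n x ^ 2 + 2 * (M n x * ξ n x) := by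
          intro x; simp only [hM, Finset.sum_range_succ]; ring
        simp_rw [this]
        have h3 := integral_add (hM2i.add hξ2i) (hcross.const_mul 2)
        simp only [Pi.add_apply] at h3
        rw [h3, integral_add hM2i hξ2i, integral_const_mul, hx0]
        ring
      have e2 : ∫ x, ξ n x ^ 2 ∂P ≤ (1 / (n + 1 : ℝ)) ^ 2 * ∫ z, h z ^ 2 ∂Q := by
        have : ∫ z, h z ^ 2 ∂Q = ∫ x : ℕ → Z, h (x n) ^ 2 ∂P := by
          rw [← (hmp n).map_eq, integral_map (hmp n).aemeasurable]
          exact (hm.pow_const 2).aestronglyMeasurable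
        rw [this, ← integral_const_mul]
        refine integral_mono hξ2i ((hhs n).integrable_sq.const_mul _) fun x => ?_
        have := pow_le_pow_left₀ (abs_nonneg _) (hξle n x) 2
        rw [mul_pow, sq_abs, sq_abs] at this
        exact this
      rw [e1, Finset.sum_range_succ]
      exact add_le_add ih e2
  have hsum : Summable fun s : ℕ => (1 / (s + 1 : ℝ)) ^ 2 := by
    have := (summable_nat_add_iff 1).2 (Real.summable_one_div_nat_pow.2 one_lt_two)
    refine this.congr fun s => ?_
    push_cast
    rw [div_pow, one_pow]
  set C : ℝ := (∑' s : ℕ, (1 / (s + 1 : ℝ)) ^ 2) * ∫ z, h z ^ 2 ∂Q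
  have hC : ∀ n, ∫ x, M n x ^ 2 ∂P ≤ C := by
    intro n
    refine (hsq n).trans ?_
    rw [← Finset.sum_mul]
    exact mul_le_mul_of_nonneg_right (hsum.sum_le_tsum _ fun _ _ => by positivity)
      (integral_nonneg fun _ => sq_nonneg _)
  have hL1 : ∀ n, eLpNorm (M n) 1 P ≤ (Real.toNNReal (1 + C) : ENNReal) := by
    intro n
    have hi : Integrable (M n) P := (hM2 n).integrable (by norm_num)
    rw [eLpNorm_one_eq_lintegral_enorm, ← ofReal_integral_norm_eq_lintegral_enorm hi]
    refine ENNReal.ofReal_le_ofReal ?_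
    calc ∫ x, ‖M n x‖ ∂P ≤ ∫ x, (1 + M n x ^ 2) ∂P := by
          refine integral_mono hi.norm ((integrable_const _).add (hM2 n).integrable_sq) fun x => ?_
          simp only [Real.norm_eq_abs]
          nlinarith [sq_abs (M n x), sq_nonneg (|M n x| - 1), abs_nonneg (M n x)]
      _ = 1 + ∫ x, M n x ^ 2 ∂P := by
          rw [integral_add (integrable_const _) (hM2 n).integrable_sq]; simp
      _ ≤ 1 + C := by linarith [hC n]
  filter_upwards [hMart.submartingale.ae_tendsto_limitProcess hL1] with x hx
  refine tendsto_average_of_tendsto_sum_div (hx.congr fun n => ?_)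
  refine Finset.sum_congr rfl fun s _ => ?_
  simp only [hξ]; ring

end Average

/-- The path that follows `x` before time `T` and restarts with `y` at time `T`. -/
def spliceAt (T : ℕ) (p : (ℕ → Z) × (ℕ → Z)) : ℕ → Z :=
  fun t => if t < T then p.1 t else p.2 (t - T)

lemma measurable_spliceAt (T : ℕ) : Measurable (spliceAt (Z := Z) T) := by
  refine measurable_pi_iff.2 fun t => ?_
  by_cases h : t < T
  · simp only [spliceAt, h, if_true]; fun_prop
  · simp only [spliceAt, h, if_false]; fun_prop

lemma measurePreserving_spliceAt (Q : Measure Z) [IsProbabilityMeasure Q] (T : ℕ) :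
    MeasurePreserving (spliceAt (Z := Z) T)
      ((Measure.infinitePi fun _ : ℕ => Q).prod (Measure.infinitePi fun _ : ℕ => Q))
      (Measure.infinitePi fun _ : ℕ => Q) := by
  refine ⟨measurable_spliceAt T, Measure.eq_infinitePi _ fun s B hB => ?_⟩
  rw [Measure.map_apply (measurable_spliceAt T) (.pi s.countable_toSet fun _ _ => hB _)]
  set s₁ := s.filter (· < T)
  set s₂ := s.filter (¬ · < T)
  have hinj : Set.InjOn (fun t => t - T) (s₂ : Set ℕ) := by
    intro a ha b hb hab
    simp only [s₂, Finset.coe_filter, Set.mem_ofPred_eq] at ha hb hab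
    omega
  have hpre : spliceAt T ⁻¹' (s : Set ℕ).pi B =
      (s₁ : Set ℕ).pi B ×ˢ ((s₂.image fun t => t - T : Finset ℕ) : Set ℕ).pi fun t => B (t + T) := by
    ext ⟨x, y⟩
    simp only [spliceAt, Set.mem_preimage, Set.mem_pi, Set.mem_prod, Finset.mem_coe,
      Finset.mem_image, s₁, s₂, Finset.mem_filter]
    constructor
    · intro h
      refine ⟨fun t ht => by simpa [ht.2] using h t ht.1, ?_⟩
      rintro _ ⟨t, ht, rfl⟩
      have := h t ht.1
      rw [if_neg ht.2] at this
      rwa [Nat.sub_add_cancel (not_lt.1 ht.2)]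
    · rintro ⟨h1, h2⟩ t ht
      by_cases htT : t < T
      · simpa [htT] using h1 t ⟨ht, htT⟩
      · have := h2 (t - T) ⟨t, ⟨ht, htT⟩, rfl⟩
        rw [Nat.sub_add_cancel (not_lt.1 htT)] at this
        simpa [htT] using this
  rw [hpre, Measure.prod_prod, Measure.infinitePi_pi _ fun i _ => hB i,
    Measure.infinitePi_pi _ fun i _ => hB _, Finset.prod_image hinj,
    ← Finset.prod_filter_mul_prod_filter_not s (· < T)]
  congr 1
  refine Finset.prod_congr rfl fun t ht => ?_
  rw [Nat.sub_add_cancel (not_lt.1 (Finset.mem_filter.1 ht).2)]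

/-- If a measurable property of a state and an independent path holds almost surely at every
state, it holds almost surely at the state reached at time `T` and the path from then on. -/
lemma ae_shift_of_forall_ae {S : Type*} [MeasurableSpace S] (T : ℕ)
    {f : (ℕ → Z) → S} (hf : Measurable f)
    (hdep : ∀ x x' : ℕ → Z, (∀ t < T, x t = x' t) → f x = f x')
    {G : Set (S × (ℕ → Z))} (hG : MeasurableSet G)
    (h : ∀ x, ∀ᵐ y ∂(Measure.infinitePi fun _ : ℕ => Q), (f x, y) ∈ G) :
    ∀ᵐ x ∂(Measure.infinitePi fun _ : ℕ => Q), (f x, fun t => x (T + t)) ∈ G := by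
  have hmeas : MeasurableSet {x : ℕ → Z | (f x, fun t => x (T + t)) ∈ G} :=
    (hf.prodMk (by fun_prop)) hG
  rw [← (measurePreserving_spliceAt Q T).map_eq,
    ae_map_iff (measurable_spliceAt T).aemeasurable hmeas]
  have key : ∀ p : (ℕ → Z) × (ℕ → Z),
      (f (spliceAt T p), fun t => spliceAt T p (T + t)) = (f p.1, p.2) := by
    intro p
    refine Prod.ext (hdep _ _ fun t ht => by simp [spliceAt, ht]) ?_
    funext t; simp [spliceAt]
  simp_rw [key]
  have hG' : MeasurableSet {p : (ℕ → Z) × (ℕ → Z) | (f p.1, p.2) ∈ G} :=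
    ((hf.comp measurable_fst).prodMk measurable_snd) hG
  exact (Measure.ae_prod_iff_ae_ae hG').2 (ae_of_all _ h)

end ProductSpace

section ProfileLikelihood

variable {A Y : Type*}

/-- Likelihood of a history under a single profile of densities. -/
def profileLikelihood (f : A → Y → ℝ) (h : List (A × Y)) : ℝ :=
  (h.map fun p => f p.1 p.2).prod

lemma profileLikelihood_cons (f : A → Y → ℝ) (p : A × Y) (h : List (A × Y)) :
    profileLikelihood f (p :: h) = f p.1 p.2 * profileLikelihood f h := by
  simp [profileLikelihood]

lemma profileLikelihood_append (f : A → Y → ℝ) (h h' : List (A × Y)) :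
    profileLikelihood f (h ++ h') = profileLikelihood f h * profileLikelihood f h' := by
  simp [profileLikelihood]

lemma profileLikelihood_pos {f : A → Y → ℝ} (hf : ∀ a y, 0 < f a y) (h : List (A × Y)) :
    0 < profileLikelihood f h := by
  induction h with
  | nil => simp [profileLikelihood]
  | cons p h ih => rw [profileLikelihood_cons]; exact mul_pos (hf _ _) ih

end ProfileLikelihood

section Measurability

lemma measurable_of_finite_index {B Z W : Type*} [Finite B] [MeasurableSpace B]
    [MeasurableSingletonClass B] [MeasurableSpace Z] [MeasurableSpace W] {f : B → Z → W}
    (hf : ∀ b, Measurable (f b)) {g : Z → B} (hg : Measurable g) :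
    Measurable fun z => f (g z) z := by
  have : Measurable fun p : B × Z => f p.1 p.2 := measurable_from_prod_countable_right hf
  exact this.comp (hg.prodMk measurable_id)

variable {A Y : Type*} [MeasurableSpace Y] {E : Environment A Y} {d : ℕ}

lemma Model.measurable_dens (θ : Model E d) (a : A) (ω : θ.params) : Measurable (θ.dens a ω) :=
  (θ.admissible ω.1 ω.2).measurable a

lemma Model.measurable_bayes (θ : Model E d) (a : A) :
    Measurable fun p : Y × θ.Belief => θ.bayes a p.1 p.2 := by
  have h : ∀ ω : θ.params, Measurable fun p : Y × θ.Belief => p.2.1 ω * θ.dens a ω p.1 := by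
    intro ω
    exact ((measurable_pi_apply ω).comp (measurable_subtype_coe.comp measurable_snd)).mul
      ((θ.measurable_dens a ω).comp measurable_fst)
  refine Measurable.subtype_mk (measurable_pi_iff.2 fun ω => ?_)
  exact (h ω).div (Finset.measurable_fun_sum _ fun ω' _ => h ω')

lemma Model.likelihood_eq_sum (θ : Model E d) (π₀ : θ.Belief) (h : List (A × Y)) :
    θ.likelihood π₀ h =
      ∑ ω : θ.params, π₀.1 ω * profileLikelihood (fun a => θ.dens a ω) h := rfl

lemma Model.likelihood_pos (θ : Model E d) {π₀ : θ.Belief} (hπ : θ.FullSupport π₀)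
    (h : List (A × Y)) : 0 < θ.likelihood π₀ h := by
  have : Nonempty θ.params := θ.nonempty.to_subtype
  rw [θ.likelihood_eq_sum]
  exact Finset.sum_pos (fun ω _ => mul_pos (hπ ω)
    (profileLikelihood_pos (θ.admissible ω.1 ω.2).pos h)) Finset.univ_nonempty

variable [Finite A] [MeasurableSpace A] [MeasurableSingletonClass A]
  {Z : Type*} [MeasurableSpace Z] {r : Z → List (A × Y) → A} {X : Z → ℕ → A → Y} {t : ℕ}

lemma measurable_outcome {s : ℕ} (hX : Measurable fun z => X z s) {a : Z → A}
    (ha : Measurable a) : Measurable fun z => X z s (a z) :=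
  measurable_of_finite_index (f := fun a z => X z s a)
    (fun a => (measurable_pi_apply a).comp hX) ha

lemma measurable_profileLikelihood_history {f : A → Y → ℝ} (hf : ∀ a, Measurable (f a))
    (ha : ∀ s < t, Measurable fun z => r z (history (r z) (X z) s))
    (hX : ∀ s < t, Measurable fun z => X z s) :
    Measurable fun z => profileLikelihood f (history (r z) (X z) t) := by
  induction t with
  | zero => exact measurable_const
  | succ t ih =>
    simp only [history, profileLikelihood_cons]
    refine Measurable.mul ?_ (ih (fun s hs => ha s (by omega)) fun s hs => hX s (by omega))
    have h1 := ha t (by omega)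
    exact measurable_of_finite_index
      (f := fun a z => f a (X z t (r z (history (r z) (X z) t))))
      (fun a => (hf a).comp (measurable_outcome (hX t (by omega)) h1)) h1

lemma measurable_posterior_history (θ : Model E d) {π₀ : Z → θ.Belief} (hπ : Measurable π₀)
    (ha : ∀ s < t, Measurable fun z => r z (history (r z) (X z) s))
    (hX : ∀ s < t, Measurable fun z => X z s) :
    Measurable fun z => θ.posterior (π₀ z) (history (r z) (X z) t) := by
  induction t with
  | zero => exact hπ
  | succ t ih =>
    simp only [history, Model.posterior]
    have h0 := ih (fun s hs => ha s (by omega)) fun s hs => hX s (by omega)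
    have h1 := ha t (by omega)
    exact measurable_of_finite_index
      (f := fun a z => θ.bayes a (X z t (r z (history (r z) (X z) t)))
        (θ.posterior (π₀ z) (history (r z) (X z) t)))
      (fun a => (θ.measurable_bayes a).comp
        ((measurable_outcome (hX t (by omega)) h1).prodMk h0)) h1

lemma measurable_dogmatic_action (θ : Model E d) {π₀ : Z → θ.Belief} (hπ : Measurable π₀)
    {pol : θ.Belief → A} (hpol : Measurable pol) :
    ∀ t, (∀ s < t, Measurable fun z => X z s) →
      Measurable fun z => Modeler.rule ⟨θ, π₀ z, pol⟩
        (history (Modeler.rule ⟨θ, π₀ z, pol⟩) (X z) t) := by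
  intro t
  induction t using Nat.strong_induction_on with
  | _ t ih =>
    intro hX
    exact hpol.comp (measurable_posterior_history (r := fun z => Modeler.rule ⟨θ, π₀ z, pol⟩)
      θ hπ (fun s hs => ih s hs fun u hu => hX u (hu.trans hs)) hX)

lemma measurable_likelihood_history (M : Modeler E d)
    (ha : ∀ s < t, Measurable fun z => r z (history (r z) (X z) s))
    (hX : ∀ s < t, Measurable fun z => X z s) :
    Measurable fun z => M.likelihood (history (r z) (X z) t) := by
  simp only [Modeler.likelihood, Model.likelihood_eq_sum]
  exact Finset.measurable_fun_sum _ fun ω _ => measurable_const.mul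
    (measurable_profileLikelihood_history (fun a => M.model.measurable_dens a ω) ha hX)

lemma measurable_modelChoice_history (α : ℝ) (M Mc : Modeler E d)
    (ha : ∀ s < t, Measurable fun z => r z (history (r z) (X z) s))
    (hX : ∀ s < t, Measurable fun z => X z s) :
    Measurable fun z => Modeler.modelChoice α M Mc (history (r z) (X z) t) := by
  induction t with
  | zero => exact measurable_const
  | succ t ih =>
    have h0 := ih (fun s hs => ha s (by omega)) fun s hs => hX s (by omega)
    have hnot : Measurable fun z => !Modeler.modelChoice α M Mc (history (r z) (X z) t) :=
      (measurable_of_countable Bool.not).comp h0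
    have hl : ∀ b : Z → Bool, Measurable b → Measurable fun z =>
        (Modeler.pick M Mc (b z)).likelihood (history (r z) (X z) (t + 1)) := fun b hb =>
      measurable_of_finite_index
        (f := fun b z => (Modeler.pick M Mc b).likelihood (history (r z) (X z) (t + 1)))
        (fun b => measurable_likelihood_history _ ha hX) hb
    exact Measurable.ite (measurableSet_lt measurable_const ((hl _ hnot).div (hl _ h0))) hnot h0

lemma measurable_switcher_action (α : ℝ) {M Mc : Modeler E d}
    (hM : Measurable M.policy) (hMc : Measurable Mc.policy) :
    ∀ t, (∀ s < t, Measurable fun z => X z s) →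
      Measurable fun z => Modeler.switcherRule α M Mc
        (history (Modeler.switcherRule α M Mc) (X z) t) := by
  intro t
  induction t using Nat.strong_induction_on with
  | _ t ih =>
    intro hX
    have ha : ∀ s < t, Measurable fun z => Modeler.switcherRule α M Mc
        (history (Modeler.switcherRule α M Mc) (X z) s) :=
      fun s hs => ih s hs fun u hu => hX u (hu.trans hs)
    refine measurable_of_finite_index
      (f := fun b z => (Modeler.pick M Mc b).rule (history (Modeler.switcherRule α M Mc) (X z) t))
      (fun b => ?_) (measurable_modelChoice_history (r := fun _ => Modeler.switcherRule α M Mc)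
        α M Mc ha hX)
    have hp : Measurable (Modeler.pick M Mc b).policy := by cases b <;> assumption
    exact hp.comp (measurable_posterior_history (r := fun _ => Modeler.switcherRule α M Mc) _
      measurable_const ha hX)

end Measurability

section Histories

variable {A Y : Type*}

lemma history_congr {rule : List (A × Y) → A} {x x' : ℕ → A → Y} {T : ℕ}
    (h : ∀ t < T, x t = x' t) : history rule x T = history rule x' T := by
  induction T with
  | zero => rfl
  | succ T ih => simp only [history, ih fun t ht => h t (by omega), h T (by omega)]

variable [MeasurableSpace Y] {E : Environment A Y} {d : ℕ}

lemma Model.posterior_append (θ : Model E d) (π₀ : θ.Belief) (h h' : List (A × Y)) :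
    θ.posterior π₀ (h' ++ h) = θ.posterior (θ.posterior π₀ h) h' := by
  induction h' with
  | nil => rfl
  | cons p h' ih => simp only [List.cons_append, Model.posterior, ih]

lemma Model.fullSupport_posterior (θ : Model E d) {π₀ : θ.Belief} (hπ : θ.FullSupport π₀)
    (h : List (A × Y)) : θ.FullSupport (θ.posterior π₀ h) := by
  induction h with
  | nil => exact hπ
  | cons p h ih =>
    exact fun ω => div_pos (mul_pos (ih ω) ((θ.admissible ω.1 ω.2).pos _ _))
      (θ.predictive_pos _ _ _)

/-- While the switcher keeps the initial model from time `T` on, she acts as the dogmatic modeler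
who starts at time `T` with the current posterior. -/
lemma history_switcher_eq_append {α : ℝ} {M Mc : Modeler E d} {x : ℕ → A → Y} {T : ℕ}
    (h : ∀ t ≥ T, Modeler.modelChoice α M Mc
      (history (Modeler.switcherRule α M Mc) x t) = false) (s : ℕ) :
    history (Modeler.switcherRule α M Mc) x (T + s) =
      history (Modeler.rule ⟨M.model, M.model.posterior M.prior
          (history (Modeler.switcherRule α M Mc) x T), M.policy⟩) (fun t => x (T + t)) s ++
        history (Modeler.switcherRule α M Mc) x T := by
  induction s with
  | zero => rfl
  | succ s ih =>
    have hr : Modeler.switcherRule α M Mc (history (Modeler.switcherRule α M Mc) x (T + s)) =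
        Modeler.rule ⟨M.model, M.model.posterior M.prior
          (history (Modeler.switcherRule α M Mc) x T), M.policy⟩
          (history (Modeler.rule ⟨M.model, M.model.posterior M.prior
          (history (Modeler.switcherRule α M Mc) x T), M.policy⟩) (fun t => x (T + t)) s) := by
      conv_lhs => rw [Modeler.switcherRule, h (T + s) (by omega), ih]
      change M.policy (M.model.posterior M.prior (_ ++ _)) = _
      rw [Model.posterior_append]
      rfl
    rw [← add_assoc]
    simp only [history, hr, List.cons_append]
    rw [ih]

/-- While the initial model is kept, the Bayes factor of the competing model is at most `α`. -/
lemma likelihood_ratio_le_of_modelChoice_eq_false {α : ℝ} {M Mc : Modeler E d} {p : A × Y}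
    {h : List (A × Y)} (h0 : Modeler.modelChoice α M Mc h = false)
    (h1 : Modeler.modelChoice α M Mc (p :: h) = false) :
    Mc.likelihood (p :: h) / M.likelihood (p :: h) ≤ α := by
  by_contra hlt
  rw [not_le] at hlt
  simp [Modeler.modelChoice, h0, Modeler.pick, hlt] at h1

end Histories

section Bellman

lemma exists_measurable_argmax {A B : Type*} [Fintype A] [Nonempty A] [MeasurableSpace A]
    [MeasurableSingletonClass A] [MeasurableSpace B] {f : A → B → ℝ} (hf : ∀ a, Measurable (f a)) :
    ∃ g : B → A, Measurable g ∧ ∀ b a, f a b ≤ f (g b) b := by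
  classical
  suffices h : ∀ s : Finset A, s.Nonempty →
      ∃ g : B → A, Measurable g ∧ ∀ b, ∀ a ∈ s, f a b ≤ f (g b) b by
    obtain ⟨g, hg, h⟩ := h Finset.univ Finset.univ_nonempty
    exact ⟨g, hg, fun b a => h b a (Finset.mem_univ a)⟩
  intro s hs
  induction hs using Finset.Nonempty.cons_induction with
  | singleton a => exact ⟨fun _ => a, measurable_const, by simp⟩
  | cons a s has hs ih =>
    obtain ⟨g, hg, h⟩ := ih
    refine ⟨fun b => if f (g b) b ≤ f a b then a else g b,
      Measurable.ite (measurableSet_le (measurable_of_finite_index hf hg) (hf a))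
        measurable_const hg, fun b c hc => ?_⟩
    rcases Finset.mem_cons.1 hc with rfl | hc
    · dsimp only
      split_ifs with hle
      · exact le_rfl
      · exact (not_le.1 hle).le
    · dsimp only
      split_ifs with hle
      · exact (h b c hc).trans hle
      · exact h b c hc

variable {A Y : Type*} [MeasurableSpace Y] {E : Environment A Y} {d : ℕ}

namespace Environment.Admissible

variable {f : A → Y → ℝ}

lemma integrable_density (hf : E.Admissible f) (a : A) : Integrable (f a) E.ν :=
  ⟨(hf.measurable a).aestronglyMeasurable, by
    rw [hasFiniteIntegral_iff_ofReal (ae_of_all _ fun y => (hf.pos a y).le),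
      hf.lintegral_eq_one a]
    exact ENNReal.one_lt_top⟩

lemma integral_density (hf : E.Admissible f) (a : A) : ∫ y, f a y ∂E.ν = 1 := by
  rw [integral_eq_lintegral_of_nonneg_ae (ae_of_all _ fun y => (hf.pos a y).le)
    (hf.measurable a).aestronglyMeasurable, hf.lintegral_eq_one a, ENNReal.toReal_one]

lemma integrable_u_mul (hf : E.Admissible f) (a : A) : Integrable (fun y => E.u a y * f a y) E.ν := by
  have h := hf.integrable_u a
  have h2 := (integrable_withDensity_iff_integrable_smul' (g := E.u a)
    (hf.measurable a).ennreal_ofReal (ae_of_all _ fun _ => ENNReal.ofReal_lt_top)).1 h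
  refine h2.congr (ae_of_all _ fun y => ?_)
  simp [ENNReal.toReal_ofReal (hf.pos a y).le, mul_comm]

end Environment.Admissible

namespace Model

variable (θ : Model E d)

lemma continuous_bayes (a : A) (y : Y) : Continuous (θ.bayes a y) := by
  have h : ∀ ω : θ.params, Continuous fun π : θ.Belief => π.1 ω * θ.dens a ω y := fun ω =>
    ((continuous_apply ω).comp continuous_subtype_val).mul continuous_const
  refine Continuous.subtype_mk (continuous_pi fun ω => ?_) _
  exact (h ω).div (continuous_finsetSum _ fun ω' _ => h ω')
    fun π => (θ.predictive_pos a y π).ne'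

variable (δ : ℝ)

lemma measurable_comp_bayes {U : θ.Belief → ℝ} (hU : Measurable U) (a : A) (π : θ.Belief) :
    Measurable fun y => U (θ.bayes a y π) :=
  hU.comp ((θ.measurable_bayes a).comp measurable_prodMk_right)

lemma integrable_continuation {U : θ.Belief → ℝ} (hU : Measurable U) {C : ℝ}
    (hC : ∀ π, |U π| ≤ C) (a : A) (ω : θ.params) (π : θ.Belief) :
    Integrable (fun y => U (θ.bayes a y π) * θ.dens a ω y) E.ν :=
  ((θ.admissible ω.1 ω.2).integrable_density a).bdd_mul
    (θ.measurable_comp_bayes hU a π).aestronglyMeasurable (ae_of_all _ fun _ => hC _)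

lemma integral_payoff {U : θ.Belief → ℝ} (hU : Measurable U) {C : ℝ}
    (hC : ∀ π, |U π| ≤ C) (a : A) (ω : θ.params) (π : θ.Belief) :
    ∫ y, (E.u a y + δ * U (θ.bayes a y π)) * θ.dens a ω y ∂E.ν =
      ∫ y, E.u a y * θ.dens a ω y ∂E.ν + δ * ∫ y, U (θ.bayes a y π) * θ.dens a ω y ∂E.ν := by
  rw [← integral_const_mul, ← integral_add ((θ.admissible ω.1 ω.2).integrable_u_mul a)
    ((θ.integrable_continuation hU hC a ω π).const_mul δ)]
  congr 1; ext y; ring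

lemma bound_continuousMap (U : C(θ.Belief, ℝ)) (π : θ.Belief) : |U π| ≤ ‖U‖ :=
  U.norm_coe_le_norm π

lemma continuous_qValue (U : C(θ.Belief, ℝ)) (a : A) :
    Continuous fun π => θ.qValue δ U π a := by
  unfold qValue
  refine continuous_finsetSum _ fun ω _ =>
    ((continuous_apply ω).comp continuous_subtype_val).mul ?_
  simp_rw [θ.integral_payoff δ U.measurable (θ.bound_continuousMap U)]
  refine continuous_const.add (continuous_const.mul ?_)
  refine continuous_of_dominated (bound := fun y => ‖U‖ * θ.dens a ω y)
    (fun π => (θ.integrable_continuation U.measurable (θ.bound_continuousMap U) a ω π).1)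
    (fun π => ae_of_all _ fun y => ?_)
    (((θ.admissible ω.1 ω.2).integrable_density a).const_mul _)
    (ae_of_all _ fun y => (U.continuous.comp (θ.continuous_bayes a y)).mul continuous_const)
  have hp := ((θ.admissible ω.1 ω.2).pos a y).le
  rw [norm_mul, Real.norm_eq_abs, Real.norm_eq_abs, abs_of_nonneg hp]
  exact mul_le_mul_of_nonneg_right (θ.bound_continuousMap U _) hp

lemma qValue_le_add {δ : ℝ} (hδ : 0 ≤ δ) (U V : C(θ.Belief, ℝ)) (π : θ.Belief) (a : A) :
    θ.qValue δ U π a ≤ θ.qValue δ V π a + δ * dist U V := by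
  have key : ∀ ω : θ.params,
      ∫ y, (E.u a y + δ * U (θ.bayes a y π)) * θ.dens a ω y ∂E.ν ≤
        ∫ y, (E.u a y + δ * V (θ.bayes a y π)) * θ.dens a ω y ∂E.ν + δ * dist U V := by
    intro ω
    rw [θ.integral_payoff δ U.measurable (θ.bound_continuousMap U),
      θ.integral_payoff δ V.measurable (θ.bound_continuousMap V), add_assoc, ← mul_add]
    refine add_le_add_right (mul_le_mul_of_nonneg_left ?_ hδ) _
    have hd := (θ.admissible ω.1 ω.2).integrable_density a
    have hVi := θ.integrable_continuation V.measurable (θ.bound_continuousMap V) a ω π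
    calc ∫ y, U (θ.bayes a y π) * θ.dens a ω y ∂E.ν
        ≤ ∫ y, (V (θ.bayes a y π) * θ.dens a ω y + dist U V * θ.dens a ω y) ∂E.ν := by
          refine integral_mono
            (θ.integrable_continuation U.measurable (θ.bound_continuousMap U) a ω π)
            (hVi.add (hd.const_mul _)) fun y => ?_
          have h1 : U (θ.bayes a y π) - V (θ.bayes a y π) ≤ dist U V :=
            (le_abs_self _).trans (ContinuousMap.dist_apply_le_dist (f := U) (g := V) _)
          have hp := ((θ.admissible ω.1 ω.2).pos a y).le
          simp only
          rw [← add_mul]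
          exact mul_le_mul_of_nonneg_right (by linarith) hp
      _ = _ := by
          rw [integral_add hVi (hd.const_mul _), integral_const_mul,
            (θ.admissible ω.1 ω.2).integral_density a, mul_one]
  unfold qValue
  have h1 : δ * dist U V = ∑ ω : θ.params, π.1 ω * (δ * dist U V) := by
    rw [← Finset.sum_mul, π.2.2, one_mul]
  rw [h1, ← Finset.sum_add_distrib]
  refine Finset.sum_le_sum fun ω _ => ?_
  rw [← mul_add]
  exact mul_le_mul_of_nonneg_left (key ω) (π.2.1 ω)

variable [Fintype A] [Nonempty A]

/-- The Bellman operator on continuous functions of the belief. -/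
def bellmanOperator (U : C(θ.Belief, ℝ)) : C(θ.Belief, ℝ) where
  toFun π := Finset.univ.sup' Finset.univ_nonempty (θ.qValue δ U π)
  continuous_toFun := Continuous.finset_sup'_apply _ fun a _ => θ.continuous_qValue δ U a

lemma bellmanOperator_le_add {δ : ℝ} (hδ : 0 ≤ δ) (U V : C(θ.Belief, ℝ)) (π : θ.Belief) :
    θ.bellmanOperator δ U π ≤ θ.bellmanOperator δ V π + δ * dist U V :=
  Finset.sup'_le Finset.univ_nonempty _ fun a _ => (θ.qValue_le_add hδ U V π a).trans
    (add_le_add_left (Finset.le_sup' (θ.qValue δ V π) (Finset.mem_univ a)) _)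

lemma contractingWith_bellmanOperator {δ : ℝ} (hδ : 0 ≤ δ) (hδ1 : δ < 1) :
    ContractingWith (⟨δ, hδ⟩ : NNReal) (θ.bellmanOperator δ) := by
  refine ⟨by exact_mod_cast hδ1, LipschitzWith.of_dist_le_mul fun U V => ?_⟩
  refine (ContinuousMap.dist_le (mul_nonneg hδ dist_nonneg)).2 fun π => ?_
  rw [Real.dist_eq, abs_le]
  have h1 := θ.bellmanOperator_le_add hδ U V π
  have h2 := θ.bellmanOperator_le_add hδ V U π
  rw [dist_comm V U] at h2
  constructor <;> linarith

/-- The dynamic programming problem has a measurable optimal policy. -/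
theorem exists_optimalPolicy [MeasurableSpace A] [MeasurableSingletonClass A] {δ : ℝ}
    (hδ : 0 ≤ δ) (hδ1 : δ < 1) : ∃ pol : θ.Belief → A, θ.OptimalPolicy δ pol := by
  set U := (θ.contractingWith_bellmanOperator hδ hδ1).fixedPoint
  have hU : θ.bellmanOperator δ U = U :=
    (θ.contractingWith_bellmanOperator hδ hδ1).fixedPoint_isFixedPt
  obtain ⟨pol, hpol, hmax⟩ := exists_measurable_argmax
    (f := fun a π => θ.qValue δ U π a) fun a => (θ.continuous_qValue δ U a).measurable
  refine ⟨pol, hpol, U, ⟨U.measurable, ⟨‖U‖, θ.bound_continuousMap U⟩, fun π => ?_⟩, hmax⟩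
  have hπ : U π = Finset.univ.sup' Finset.univ_nonempty (θ.qValue δ U π) :=
    (DFunLike.congr_fun hU π).symm
  rw [hπ]
  refine ⟨?_, ?_⟩
  · obtain ⟨a, -, ha⟩ := Finset.exists_mem_eq_sup' Finset.univ_nonempty (θ.qValue δ U π)
    exact ⟨a, ha.symm⟩
  · rintro _ ⟨a, rfl⟩
    exact Finset.le_sup' _ (Finset.mem_univ a)

end Model

end Bellman

section KullbackLeibler

variable {A Y : Type*} [MeasurableSpace Y] {E : Environment A Y} {d : ℕ}

lemma Environment.Admissible.memLp_log_truth {f : A → Y → ℝ} (hf : E.Admissible f) (a : A) :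
    MemLp (fun y => Real.log (E.qStar a y / f a y)) 2 (E.trueLaw a) := by
  obtain ⟨g, hg, hle⟩ := hf.log_ratio_bound a
  refine hg.mono ?_ ?_
  · exact (Real.measurable_log.comp
      ((E.measurable_qStar a).div (hf.measurable a))).aestronglyMeasurable
  · filter_upwards [hle] with y hy
    exact hy.trans (le_abs_self _)

lemma klDiv_qStar_eq_integral_log {f : A → Y → ℝ} (a : A) :
    E.klDiv (E.qStar a) (f a) = ∫ y, Real.log (E.qStar a y / f a y) ∂E.trueLaw a := by
  have hm : Measurable fun y => (E.qStar a y).toNNReal := (E.measurable_qStar a).real_toNNReal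
  have h := integral_withDensity_eq_integral_smul (μ := E.ν) hm
    fun y => Real.log (E.qStar a y / f a y)
  unfold Environment.klDiv Environment.trueLaw
  refine Eq.trans ?_ h.symm
  refine integral_congr_ae (ae_of_all _ fun y => ?_)
  simp [NNReal.smul_def, Real.coe_toNNReal _ (E.qStar_pos a y).le]

variable {f f' : A → Y → ℝ}

lemma log_div_eq_sub (hf : E.Admissible f) (hf' : E.Admissible f') (a : A) (y : Y) :
    Real.log (f a y / f' a y) =
      Real.log (E.qStar a y / f' a y) - Real.log (E.qStar a y / f a y) := by
  have h1 := (hf.pos a y).ne'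
  have h2 := (hf'.pos a y).ne'
  have h3 := (E.qStar_pos a y).ne'
  rw [Real.log_div h1 h2, Real.log_div h3 h2, Real.log_div h3 h1]
  ring

lemma memLp_log_div (hf : E.Admissible f) (hf' : E.Admissible f') (a : A) :
    MemLp (fun y => Real.log (f a y / f' a y)) 2 (E.trueLaw a) := by
  simp_rw [log_div_eq_sub hf hf' a]
  exact (hf'.memLp_log_truth a).sub (hf.memLp_log_truth a)

lemma integral_log_div (hf : E.Admissible f) (hf' : E.Admissible f') (a : A) :
    ∫ y, Real.log (f a y / f' a y) ∂E.trueLaw a =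
      E.klDiv (E.qStar a) (f' a) - E.klDiv (E.qStar a) (f a) := by
  simp_rw [log_div_eq_sub hf hf' a]
  rw [integral_sub ((hf'.memLp_log_truth a).integrable (by norm_num))
    ((hf.memLp_log_truth a).integrable (by norm_num)), klDiv_qStar_eq_integral_log,
    klDiv_qStar_eq_integral_log]

variable [Fintype A]

/-- Expected log-likelihood ratio of `f` over `f'` when actions have frequencies `σ`. -/
def drift (E : Environment A Y) (f f' : A → Y → ℝ) (σ : A → ℝ) : ℝ :=
  ∑ a, σ a * ∫ y, Real.log (f a y / f' a y) ∂E.trueLaw a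

lemma continuous_drift : Continuous (drift E f f') := by
  unfold drift; fun_prop

lemma drift_eq_sub (hf : E.Admissible f) (hf' : E.Admissible f') (σ : A → ℝ) :
    drift E f f' σ =
      ∑ a, σ a * E.klDiv (E.qStar a) (f' a) - ∑ a, σ a * E.klDiv (E.qStar a) (f a) := by
  unfold drift
  rw [← Finset.sum_sub_distrib]
  refine Finset.sum_congr rfl fun a _ => ?_
  rw [integral_log_div hf hf', mul_sub]

theorem Model.isCompact_berkNash (θ : Model E d) : IsCompact {σ | θ.IsBerkNash σ} := by
  have hw : ∀ ω, Continuous fun p : (A → ℝ) × θ.Belief => θ.weightedKL p.1 ω := by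
    intro ω; unfold weightedKL; fun_prop
  have hπ : ∀ ω : θ.params, Continuous fun p : (A → ℝ) × θ.Belief => p.2.1 ω := fun ω =>
    (continuous_apply ω).comp (continuous_subtype_val.comp continuous_snd)
  have hv : ∀ a, Continuous fun p : (A → ℝ) × θ.Belief => θ.myopicValue p.2 a := fun a =>
    continuous_finsetSum _ fun ω _ => (hπ ω).mul continuous_const
  have hcl : IsClosed {p : (A → ℝ) × θ.Belief | p.1 ∈ stdSimplex ℝ A ∧
      (∀ ω : θ.params, p.2.1 ω = 0 ∨ ∀ ω' ∈ θ.params, θ.weightedKL p.1 ω ≤ θ.weightedKL p.1 ω') ∧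
      ∀ a, p.1 a = 0 ∨ ∀ b, θ.myopicValue p.2 b ≤ θ.myopicValue p.2 a} := by
    have h1 : IsClosed {p : (A → ℝ) × θ.Belief | ∀ ω : θ.params, p.2.1 ω = 0 ∨
        ∀ ω' ∈ θ.params, θ.weightedKL p.1 ω ≤ θ.weightedKL p.1 ω'} := by
      simp only [Set.ofPred_forall, Set.ofPred_or]
      exact isClosed_iInter fun ω => (isClosed_eq (hπ ω) continuous_const).union
        (isClosed_iInter fun ω' => isClosed_iInter fun _ => isClosed_le (hw _) (hw _))
    have h2 : IsClosed {p : (A → ℝ) × θ.Belief | ∀ a, p.1 a = 0 ∨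
        ∀ b, θ.myopicValue p.2 b ≤ θ.myopicValue p.2 a} := by
      simp only [Set.ofPred_forall, Set.ofPred_or]
      exact isClosed_iInter fun a =>
        (isClosed_eq ((continuous_apply a).comp continuous_fst) continuous_const).union
          (isClosed_iInter fun b => isClosed_le (hv _) (hv _))
    exact ((isClosed_stdSimplex ℝ A).preimage continuous_fst).inter (h1.inter h2)
  have hcpt := (((isCompact_stdSimplex ℝ A).prod
    (isCompact_univ (X := θ.Belief))).of_isClosed_subset hcl
      fun p hp => ⟨hp.1, Set.mem_univ _⟩).image continuous_fst
  convert hcpt using 1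
  ext σ
  constructor
  · rintro ⟨hσ, π, h1, h2⟩
    exact ⟨(σ, π), ⟨hσ, fun ω => or_iff_not_imp_left.2 fun h => (h1 ω h).2,
      fun a => or_iff_not_imp_left.2 (h2 a)⟩, rfl⟩
  · rintro ⟨⟨σ', π⟩, ⟨hσ, h1, h2⟩, rfl⟩
    exact ⟨hσ, π, fun ω h => ⟨ω.2, (h1 ω).resolve_left h⟩, fun a h => (h2 a).resolve_left h⟩

/-- If `θ` is not locally KL-minimizing at `σ`, some nearby parameter fits the truth strictly
better than every parameter of `θ`. -/
lemma Family.exists_better_of_not_locallyKLMinimizing {q : Family E d} {θ : Model E d}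
    (hθ : θ ∈ q.models) {σ : A → ℝ} (h : ¬ q.LocallyKLMinimizing θ σ) {ε : ℝ} (hε : 0 < ε) :
    ∃ ω' ∈ q.Ωq ∩ Metric.thickening ε (θ.params : Set (EuclideanSpace ℝ (Fin d))),
      ∀ ω ∈ θ.params, drift E (fun a => θ.dens a ω) (fun a => q.dens a ω') σ < 0 := by
  unfold Family.LocallyKLMinimizing at h
  push Not at h
  obtain ⟨ω₀, hω₀, ω', ⟨hq, hth⟩, hpos⟩ := h ε hε
  refine ⟨ω', ⟨hq, Metric.thickening_subset_of_subset _ (fun ω hω => hω.1) hth⟩, fun ω hω => ?_⟩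
  have h1 : 0 < drift E (fun a => q.dens a ω') (fun a => q.dens a ω₀) σ := hpos
  have hadm := q.admissible ω' hq
  rw [drift_eq_sub hadm (q.admissible ω₀ (hθ.1 hω₀.1))] at h1
  rw [drift_eq_sub (θ.admissible ω hω) hadm]
  have h2 := hω₀.2 ω hω
  simp only [Model.weightedKL, hθ.2 ω₀ hω₀.1] at h2
  linarith

end KullbackLeibler

section LikelihoodRatio

variable {A Y : Type*}

lemma log_profileLikelihood_div {f f' : A → Y → ℝ} (hf : ∀ a y, 0 < f a y)
    (hf' : ∀ a y, 0 < f' a y) (r : List (A × Y) → A) (x : ℕ → A → Y) (n : ℕ) :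
    Real.log (profileLikelihood f (history r x n) / profileLikelihood f' (history r x n)) =
      ∑ s ∈ Finset.range n, Real.log (f (r (history r x s)) (x s (r (history r x s))) /
        f' (r (history r x s)) (x s (r (history r x s)))) := by
  induction n with
  | zero => simp [history, profileLikelihood]
  | succ n ih =>
    rw [Finset.sum_range_succ, ← ih]
    simp only [history, profileLikelihood_cons]
    rw [mul_div_mul_comm, Real.log_mul (div_pos (hf _ _) (hf' _ _)).ne'
      (div_pos (profileLikelihood_pos hf _) (profileLikelihood_pos hf' _)).ne', add_comm]

variable [MeasurableSpace Y] {E : Environment A Y}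
  [Fintype A] [DecidableEq A] [MeasurableSpace A] [MeasurableSingletonClass A]

/-- Along paths with converging action frequencies, the likelihood ratio of two profiles vanishes
if its expected logarithm is negative in the limit. -/
theorem ae_tendsto_profileLikelihood_div {f f' : A → Y → ℝ} (hf : E.Admissible f)
    (hf' : E.Admissible f') {r : List (A × Y) → A}
    (hr : ∀ t, Measurable[pastFiltration (A → Y) t] fun x => r (history r x t)) :
    ∀ᵐ x ∂E.pathMeasure, ∀ σ, Tendsto (actionFreq r x) atTop (𝓝 σ) → drift E f f' σ < 0 →
      Tendsto (fun n => profileLikelihood f (history r x n) / profileLikelihood f' (history r x n))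
        atTop (𝓝 0) := by
  set g : A → Y → ℝ := fun a y => Real.log (f a y / f' a y)
  set m : A → ℝ := fun a => ∫ y, g a y ∂E.trueLaw a
  set c : A → ℕ → (ℕ → A → Y) → ℝ := fun a s x => if r (history r x s) = a then 1 else 0
  have hlln : ∀ a, ∀ᵐ x ∂E.pathMeasure, Tendsto (fun n : ℕ => (n : ℝ)⁻¹ *
      ∑ s ∈ Finset.range n, c a s x * (g a (x s a) - m a)) atTop (𝓝 0) := by
    intro a
    have hmp : MeasurePreserving (fun z : A → Y => z a) (Measure.pi E.trueLaw) (E.trueLaw a) :=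
      measurePreserving_eval _ a
    have hgm : Measurable (g a) :=
      Real.measurable_log.comp ((hf.measurable a).div (hf'.measurable a))
    have hg2 : MemLp (g a) 2 (E.trueLaw a) := memLp_log_div hf hf' a
    have hg1 : MemLp (fun z : A → Y => g a (z a)) 2 (Measure.pi E.trueLaw) :=
      hg2.comp_measurePreserving hmp
    refine ae_tendsto_average_predictable (Q := Measure.pi E.trueLaw) (c := c a)
      (h := fun z => g a (z a) - m a) (fun t => ?_) (fun t x => ?_) ?_ ?_ ?_
    · exact ((measurable_of_countable (fun b : A => if b = a then (1 : ℝ) else 0)).comp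
        (hr t)).stronglyMeasurable
    · simp only [c]; split_ifs <;> simp
    · exact (hgm.comp (measurable_pi_apply a)).sub_const _
    · exact hg1.sub (memLp_const _)
    · rw [integral_sub (hg1.integrable (by norm_num)) (integrable_const _)]
      have : ∫ z : A → Y, g a (z a) ∂Measure.pi E.trueLaw = m a := by
        rw [← integral_map (f := g a) hmp.aemeasurable hgm.aestronglyMeasurable, hmp.map_eq]
      rw [this]; simp
  filter_upwards [ae_all_iff.2 hlln] with x hx σ hσ hneg
  have hsplit : ∀ n : ℕ, (n : ℝ)⁻¹ * Real.log
      (profileLikelihood f (history r x n) / profileLikelihood f' (history r x n)) =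
      ∑ a, ((n : ℝ)⁻¹ * ∑ s ∈ Finset.range n, c a s x * (g a (x s a) - m a) +
        actionFreq r x n a * m a) := by
    intro n
    have h1 : ∀ a, actionFreq r x n a * m a =
        (n : ℝ)⁻¹ * ∑ s ∈ Finset.range n, c a s x * m a := by
      intro a
      rw [← Finset.sum_mul, Finset.sum_boole, actionFreq]
      ring
    simp_rw [h1, ← mul_add, ← Finset.sum_add_distrib]
    rw [← Finset.mul_sum, log_profileLikelihood_div hf.pos hf'.pos, Finset.sum_comm]
    congr 1
    refine Finset.sum_congr rfl fun s _ => ?_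
    simp only [c, g, ite_mul, one_mul, zero_mul]
    rw [Finset.sum_eq_single (r (history r x s))]
    · simp
    · intro b _ hb; simp [hb.symm]
    · simp
  have hlim : Tendsto (fun n : ℕ => (n : ℝ)⁻¹ * Real.log
      (profileLikelihood f (history r x n) / profileLikelihood f' (history r x n)))
      atTop (𝓝 (drift E f f' σ)) := by
    simp_rw [hsplit]
    have : drift E f f' σ = ∑ a, (0 + σ a * m a) := by simp [drift, m, g]
    rw [this]
    exact tendsto_finsetSum _ fun a _ => (hx a).add ((tendsto_pi_nhds.1 hσ a).mul_const _)
  have hbot : Tendsto (fun n : ℕ => Real.log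
      (profileLikelihood f (history r x n) / profileLikelihood f' (history r x n)))
      atTop atBot := by
    refine (tendsto_natCast_atTop_atTop.atTop_mul_neg hneg hlim).congr' ?_
    filter_upwards [eventually_gt_atTop 0] with n hn
    have : (n : ℝ) ≠ 0 := by exact_mod_cast hn.ne'
    rw [mul_inv_cancel_left₀ this]
  refine (Real.tendsto_exp_atBot.comp hbot).congr fun n => ?_
  exact Real.exp_log (div_pos (profileLikelihood_pos hf.pos _) (profileLikelihood_pos hf'.pos _))

end LikelihoodRatio

section Competitor

variable {A Y : Type*} [MeasurableSpace Y] {E : Environment A Y} {d : ℕ}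

/-- The member of the `q`-family with parameter set `s`. -/
def Family.model (q : Family E d) (s : Finset (EuclideanSpace ℝ (Fin d))) (hne : s.Nonempty)
    (hs : ↑s ⊆ q.Ωq) : Model E d :=
  ⟨s, hne, q.dens, fun ω hω => q.admissible ω (hs hω)⟩

lemma Family.model_mem_models (q : Family E d) (s : Finset (EuclideanSpace ℝ (Fin d)))
    (hne : s.Nonempty) (hs : ↑s ⊆ q.Ωq) : q.model s hne hs ∈ q.models :=
  ⟨hs, fun _ _ _ => rfl⟩

lemma Model.beliefMeasure_apply (θ : Model E d) (π : θ.Belief)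
    (B : Set (EuclideanSpace ℝ (Fin d))) :
    θ.beliefMeasure π B = ∑ ω : θ.params, ENNReal.ofReal (π.1 ω) * Measure.dirac ω.1 B := by
  simp [Model.beliefMeasure, Measure.finsetSum_apply]

instance Model.isProbabilityMeasure_beliefMeasure (θ : Model E d) (π : θ.Belief) :
    IsProbabilityMeasure (θ.beliefMeasure π) := by
  constructor
  rw [θ.beliefMeasure_apply]
  simp only [measure_univ, mul_one]
  rw [← ENNReal.ofReal_sum_of_nonneg fun ω _ => π.2.1 ω, π.2.2, ENNReal.ofReal_one]

/-- A belief of a model can be approximated by full-support beliefs of any larger model. -/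
lemma exists_fullSupport_near (θ θc : Model E d) (hsub : θ.params ⊆ θc.params) (π₀ : θ.Belief)
    {η : ℝ} (hη : 0 < η) :
    ∃ πc : θc.Belief, θc.FullSupport πc ∧
      levyProkhorovDist (θ.beliefMeasure π₀) (θc.beliefMeasure πc) ≤ η := by
  classical
  wlog hη1 : η < 1 generalizing η
  · obtain ⟨πc, h1, h2⟩ := this (η := 1 / 2) (by norm_num) (by norm_num)
    exact ⟨πc, h1, h2.trans (by linarith)⟩
  set w : EuclideanSpace ℝ (Fin d) → ℝ := fun ω => if h : ω ∈ θ.params then π₀.1 ⟨ω, h⟩ else 0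
    with hw
  have hw0 : ∀ ω, 0 ≤ w ω := by
    intro ω
    simp only [hw]
    split_ifs with h
    · exact π₀.2.1 _
    · exact le_rfl
  have hwθ : ∀ ω : θ.params, π₀.1 ω = w ω := fun ω => by simp [hw, ω.2]
  have hwsum : ∑ ω ∈ θ.params, w ω = 1 := by
    rw [← π₀.2.2, ← Finset.sum_coe_sort θ.params]
    exact Finset.sum_congr rfl fun ω _ => (hwθ ω).symm
  have hwsumc : ∑ ω ∈ θc.params, w ω = 1 := by
    rw [← hwsum]
    exact (Finset.sum_subset hsub fun ω _ h => by simp [hw, h]).symm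
  have hcard : (0 : ℝ) < θc.params.card := by exact_mod_cast θc.nonempty.card_pos
  set v : EuclideanSpace ℝ (Fin d) → ℝ := fun ω => (1 - η) * w ω + η / θc.params.card with hv
  have hvw : ∀ ω, (1 - η) * w ω ≤ v ω := fun ω => by
    have := div_pos hη hcard
    simp only [hv]; linarith
  have hvpos : ∀ ω, 0 < v ω := fun ω =>
    add_pos_of_nonneg_of_pos (mul_nonneg (by linarith) (hw0 ω)) (div_pos hη hcard)
  have hvsum : ∑ ω ∈ θc.params, v ω = 1 := by
    simp only [hv]
    rw [Finset.sum_add_distrib, ← Finset.mul_sum, hwsumc, Finset.sum_const, nsmul_eq_mul,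
      mul_div_cancel₀ _ hcard.ne']
    ring
  refine ⟨⟨fun ω => v ω, fun ω => (hvpos ω).le, ?_⟩, fun ω => hvpos ω, ?_⟩
  · rw [← hvsum, ← Finset.sum_coe_sort θc.params]
  refine levyProkhorovDist_le_of_forall_le _ _ hη.le fun ε B hε _ => ?_
  have hmono : (θc.beliefMeasure ⟨fun ω => v ω, fun ω => (hvpos ω).le, by
      rw [← hvsum, ← Finset.sum_coe_sort θc.params]⟩) B ≤
      (θc.beliefMeasure ⟨fun ω => v ω, fun ω => (hvpos ω).le, by
      rw [← hvsum, ← Finset.sum_coe_sort θc.params]⟩) (Metric.thickening ε B) :=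
    measure_mono (Metric.self_subset_thickening (hη.trans hε) B)
  refine le_trans ?_ (add_le_add hmono (ENNReal.ofReal_le_ofReal hε.le))
  rw [θ.beliefMeasure_apply, θc.beliefMeasure_apply]
  simp only [hwθ]
  rw [Finset.sum_coe_sort θ.params fun ω => ENNReal.ofReal (w ω) * Measure.dirac ω B,
    Finset.sum_coe_sort θc.params fun ω => ENNReal.ofReal (v ω) * Measure.dirac ω B]
  have hone : ∑ ω ∈ θ.params, ENNReal.ofReal (η * w ω) = ENNReal.ofReal η := by
    rw [← ENNReal.ofReal_sum_of_nonneg fun ω _ => mul_nonneg hη.le (hw0 ω), ← Finset.mul_sum,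
      hwsum, mul_one]
  calc ∑ ω ∈ θ.params, ENNReal.ofReal (w ω) * Measure.dirac ω B
      ≤ ∑ ω ∈ θ.params, (ENNReal.ofReal (v ω) * Measure.dirac ω B + ENNReal.ofReal (η * w ω)) := by
        refine Finset.sum_le_sum fun ω _ => ?_
        calc ENNReal.ofReal (w ω) * Measure.dirac ω B
            ≤ (ENNReal.ofReal (v ω) + ENNReal.ofReal (η * w ω)) * Measure.dirac ω B := by
              refine mul_le_mul_left ?_ _
              rw [← ENNReal.ofReal_add (hvpos ω).le (mul_nonneg hη.le (hw0 ω))]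
              exact ENNReal.ofReal_le_ofReal (by linarith [hvw ω])
          _ ≤ _ := by
              rw [add_mul]
              exact add_le_add le_rfl (mul_le_of_le_one_right' prob_le_one)
    _ ≤ _ := by
        rw [Finset.sum_add_distrib, hone]
        exact add_le_add (Finset.sum_le_sum_of_subset hsub) le_rfl

end Competitor

section Persistence

variable {A Y : Type*} [MeasurableSpace Y] {E : Environment A Y} {d : ℕ}

/-- The paths on which, for the dogmatic modeler with belief `p.1` and path `p.2`, some parameter
of `s` becomes infinitely more likely than all parameters of `θ`. -/
def outperformedSet (q : Family E d) (θ : Model E d) (pol : θ.Belief → A)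
    (s : Finset (EuclideanSpace ℝ (Fin d))) : Set (θ.Belief × (ℕ → A → Y)) :=
  {p | ∃ ω' ∈ s, ∀ ω ∈ θ.params, Tendsto (fun t =>
    profileLikelihood (fun a => θ.dens a ω) (history (Modeler.rule ⟨θ, p.1, pol⟩) p.2 t) /
    profileLikelihood (fun a => q.dens a ω') (history (Modeler.rule ⟨θ, p.1, pol⟩) p.2 t))
    atTop (𝓝 0)}

variable {q : Family E d} {θ : Model E d} {pol : θ.Belief → A}
  {s : Finset (EuclideanSpace ℝ (Fin d))}

lemma measurableSet_outperformedSet [Finite A] [MeasurableSpace A] [MeasurableSingletonClass A]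
    (hpol : Measurable pol) (hs : ↑s ⊆ q.Ωq) :
    MeasurableSet (outperformedSet q θ pol s) := by
  have hX : ∀ u : ℕ, Measurable fun p : θ.Belief × (ℕ → A → Y) => p.2 u := fun u =>
    (measurable_pi_apply u).comp measurable_snd
  have hL : ∀ {f : A → Y → ℝ}, (∀ a, Measurable (f a)) → ∀ t,
      Measurable fun p : θ.Belief × (ℕ → A → Y) =>
        profileLikelihood f (history (Modeler.rule ⟨θ, p.1, pol⟩) p.2 t) := fun hf t =>
    measurable_profileLikelihood_history (r := fun p => Modeler.rule ⟨θ, p.1, pol⟩)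
      (X := fun p : θ.Belief × (ℕ → A → Y) => p.2) hf
      (fun u _ => measurable_dogmatic_action θ measurable_fst hpol u fun v _ => hX v)
      fun u _ => hX u
  have : outperformedSet q θ pol s = ⋃ ω' ∈ s, ⋂ ω ∈ θ.params, {p | Tendsto (fun t =>
    profileLikelihood (fun a => θ.dens a ω) (history (Modeler.rule ⟨θ, p.1, pol⟩) p.2 t) /
    profileLikelihood (fun a => q.dens a ω') (history (Modeler.rule ⟨θ, p.1, pol⟩) p.2 t))
    atTop (𝓝 0)} := by
    ext p; simp [outperformedSet]
  rw [this]
  refine s.measurableSet_biUnion fun ω' hω' => θ.params.measurableSet_biInter fun ω hω => ?_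
  exact measurableSet_tendsto _ fun t => (hL (θ.admissible ω hω).measurable t).div
    (hL (q.admissible ω' (hs hω')).measurable t)

/-- If the parameters in `s` beat `θ` at all Berk-Nash equilibria, then the dogmatic modeler is
almost surely outperformed. -/
lemma ae_mem_outperformedSet [Fintype A] [DecidableEq A] [MeasurableSpace A] [MeasurableSingletonClass A]
    {δ : ℝ} (hconv : θ.DogmaticConvergence δ) (hpol : θ.OptimalPolicy δ pol) (hs : ↑s ⊆ q.Ωq)
    (hbeat : ∀ σ, θ.IsBerkNash σ → ∃ ω' ∈ s, ∀ ω ∈ θ.params,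
      drift E (fun a => θ.dens a ω) (fun a => q.dens a ω') σ < 0)
    {π : θ.Belief} (hπ : θ.FullSupport π) :
    ∀ᵐ x ∂E.pathMeasure, (π, x) ∈ outperformedSet q θ pol s := by
  have hr : ∀ t, Measurable[pastFiltration (A → Y) t] fun x : ℕ → A → Y =>
      Modeler.rule ⟨θ, π, pol⟩ (history (Modeler.rule ⟨θ, π, pol⟩) x t) := by
    intro t
    let _ : MeasurableSpace (ℕ → A → Y) := pastFiltration (A → Y) t
    exact measurable_dogmatic_action (X := fun x : ℕ → A → Y => x) θ
      (π₀ := fun _ => π) measurable_const hpol.1 t fun u hu => measurable_coord_pastFiltration hu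
  have hall : ∀ᵐ x ∂E.pathMeasure, ∀ ω' : s, ∀ ω : θ.params, ∀ σ,
      Tendsto (actionFreq (Modeler.rule ⟨θ, π, pol⟩) x) atTop (𝓝 σ) →
      drift E (fun a => θ.dens a ω) (fun a => q.dens a ω') σ < 0 → Tendsto (fun t =>
        profileLikelihood (fun a => θ.dens a ω) (history (Modeler.rule ⟨θ, π, pol⟩) x t) /
        profileLikelihood (fun a => q.dens a ω') (history (Modeler.rule ⟨θ, π, pol⟩) x t))
        atTop (𝓝 0) :=
    ae_all_iff.2 fun ω' => ae_all_iff.2 fun ω =>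
      ae_tendsto_profileLikelihood_div (θ.admissible ω.1 ω.2) (q.admissible ω'.1 (hs ω'.2)) hr
  filter_upwards [hconv π pol hπ hpol, hall] with x ⟨σ, hσ, hlim⟩ hx
  obtain ⟨ω', hω', hneg⟩ := hbeat σ hσ
  exact ⟨ω', hω', fun ω hω => hx ⟨ω', hω'⟩ ⟨ω, hω⟩ σ hlim (hneg ω hω)⟩

lemma tendsto_likelihood_div_of_outperformed {s' : Finset (EuclideanSpace ℝ (Fin d))}
    (hss' : s ⊆ s') (hne : s'.Nonempty) (hs' : ↑s' ⊆ q.Ωq) {π π₀ : θ.Belief} {x : ℕ → A → Y}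
    (hmem : (π, x) ∈ outperformedSet q θ pol s) {πc : (q.model s' hne hs').Belief}
    (hπc : (q.model s' hne hs').FullSupport πc) (h₀ : List (A × Y)) :
    Tendsto (fun t => θ.likelihood π₀ (history (Modeler.rule ⟨θ, π, pol⟩) x t ++ h₀) /
      (q.model s' hne hs').likelihood πc (history (Modeler.rule ⟨θ, π, pol⟩) x t ++ h₀))
      atTop (𝓝 0) := by
  obtain ⟨ω', hω', hlim⟩ := hmem
  set H := history (Modeler.rule ⟨θ, π, pol⟩) x
  let θc := q.model s' hne hs'
  let w' : θc.params := ⟨ω', hss' hω'⟩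
  have hpos' : ∀ ω : θc.params, ∀ a y, 0 < θc.dens a ω y := fun ω => (θc.admissible ω.1 ω.2).pos
  have hposθ : ∀ ω : θ.params, ∀ a y, 0 < θ.dens a ω y := fun ω => (θ.admissible ω.1 ω.2).pos
  have hlow : ∀ h, πc.1 w' * profileLikelihood (fun a => q.dens a ω') h ≤
      θc.likelihood πc h := by
    intro h
    rw [Model.likelihood_eq_sum]
    exact Finset.single_le_sum
      (f := fun ω : θc.params => πc.1 ω * profileLikelihood (fun a => θc.dens a ω) h)
      (fun ω _ => mul_nonneg (πc.2.1 ω) (profileLikelihood_pos (hpos' ω) h).le)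
      (Finset.mem_univ w')
  have hlowpos : ∀ h, 0 < πc.1 w' * profileLikelihood (fun a => q.dens a ω') h := fun h =>
    mul_pos (hπc w') (profileLikelihood_pos (hpos' w') h)
  have hθ0 : ∀ h, 0 ≤ θ.likelihood π₀ h := fun h => by
    rw [Model.likelihood_eq_sum]
    exact Finset.sum_nonneg fun ω _ =>
      mul_nonneg (π₀.2.1 ω) (profileLikelihood_pos (hposθ ω) h).le
  refine squeeze_zero (g := fun t => ∑ ω : θ.params,
      (π₀.1 ω * profileLikelihood (fun a => θ.dens a ω) h₀ /
        (πc.1 w' * profileLikelihood (fun a => q.dens a ω') h₀)) *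
      (profileLikelihood (fun a => θ.dens a ω) (H t) /
        profileLikelihood (fun a => q.dens a ω') (H t)))
    (fun t => div_nonneg (hθ0 _) ((hlowpos _).le.trans (hlow _))) (fun t => ?_) ?_
  · refine (div_le_div_of_nonneg_left (hθ0 _) (hlowpos _) (hlow _)).trans_eq ?_
    rw [Model.likelihood_eq_sum, Finset.sum_div]
    refine Finset.sum_congr rfl fun ω _ => ?_
    rw [profileLikelihood_append, profileLikelihood_append, ← mul_div_mul_comm]
    congr 1 <;> ring
  · have := tendsto_finsetSum (Finset.univ : Finset θ.params) fun ω _ =>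
      (hlim ω.1 ω.2).const_mul (π₀.1 ω * profileLikelihood (fun a => θ.dens a ω) h₀ /
        (πc.1 w' * profileLikelihood (fun a => q.dens a ω') h₀))
    simpa using this

/-- A model that is outperformed by a competitor with a larger parameter set does not persist. -/
theorem not_persists_of_outperformed [Fintype A] [MeasurableSpace A] [MeasurableSingletonClass A]
    {α : ℝ} (hα : 0 < α) (hpol : Measurable pol)
    (hout : ∀ π, θ.FullSupport π → ∀ᵐ x ∂E.pathMeasure, (π, x) ∈ outperformedSet q θ pol s)
    {s' : Finset (EuclideanSpace ℝ (Fin d))} (hss' : s ⊆ s') (hne : s'.Nonempty)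
    (hs' : ↑s' ⊆ q.Ωq) {π₀ : θ.Belief} (hπ₀ : θ.FullSupport π₀)
    {πc : (q.model s' hne hs').Belief} (hπc : (q.model s' hne hs').FullSupport πc)
    {polc : (q.model s' hne hs').Belief → A} (hpolc : Measurable polc) :
    ¬ Modeler.Persists α ⟨θ, π₀, pol⟩ ⟨q.model s' hne hs', πc, polc⟩ := by
  set M : Modeler E d := ⟨θ, π₀, pol⟩
  set Mc : Modeler E d := ⟨q.model s' hne hs', πc, polc⟩
  set r := Modeler.switcherRule α M Mc
  have hr : ∀ t, Measurable fun x : ℕ → A → Y => r (history r x t) := fun t =>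
    measurable_switcher_action (X := fun x : ℕ → A → Y => x) α hpol hpolc t
      fun u _ => measurable_pi_apply u
  have hshift : ∀ T : ℕ, ∀ᵐ x ∂E.pathMeasure,
      (θ.posterior π₀ (history r x T), fun t => x (T + t)) ∈ outperformedSet q θ pol s := by
    intro T
    refine ae_shift_of_forall_ae (Q := Measure.pi E.trueLaw) T
      (f := fun x => θ.posterior π₀ (history r x T))
      (measurable_posterior_history (r := fun _ => r) (X := fun x : ℕ → A → Y => x) θ
        measurable_const (fun u _ => hr u) fun u _ => measurable_pi_apply u)
      (fun x x' h => by rw [history_congr h]) (measurableSet_outperformedSet hpol ?_)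
      fun x => hout _ (θ.fullSupport_posterior hπ₀ _)
    exact (Finset.coe_subset.2 hss').trans hs'
  unfold Modeler.Persists
  rw [not_lt, nonpos_iff_eq_zero]
  refine measure_mono_null ?_ (ae_iff.1 (ae_all_iff.2 hshift))
  intro x hx hall
  obtain ⟨T, hT⟩ := eventually_atTop.1 (hx : ∀ᶠ t in atTop, _)
  have happ := history_switcher_eq_append hT
  have hlim := tendsto_likelihood_div_of_outperformed (π₀ := π₀) hss' hne hs' (hall T) hπc
    (history r x T)
  have hev := hlim.eventually (gt_mem_nhds (inv_pos.2 hα))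
  obtain ⟨n, hn, hn1⟩ := (hev.and (eventually_ge_atTop 1)).exists
  obtain ⟨n, rfl⟩ : ∃ k, n = k + 1 := ⟨n - 1, by omega⟩
  have hle := likelihood_ratio_le_of_modelChoice_eq_false (hT (T + n) (by omega))
    (hT (T + n + 1) (by omega))
  change Mc.likelihood (history r x (T + (n + 1))) / M.likelihood (history r x (T + (n + 1))) ≤ α
    at hle
  rw [happ (n + 1)] at hle
  rw [div_lt_iff₀ ((q.model s' hne hs').likelihood_pos hπc _), inv_mul_eq_div,
    lt_div_iff₀ hα, mul_comm] at hn
  replace hle := (div_le_iff₀ (θ.likelihood_pos hπ₀ _)).1 hle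
  exact absurd hn (not_lt.2 hle)

end Persistence

end

end Misspec

theorem theorem5 {A Y : Type*} [Fintype A] [DecidableEq A] [MeasurableSpace A]
    [MeasurableSingletonClass A] [MeasurableSpace Y] (E : Misspec.Environment A Y)
    (δ : ℝ) (hδ0 : 0 ≤ δ) (hδ1 : δ < 1) (α : ℝ) (hα : 1 < α) {d : ℕ}
    (q : Misspec.Family E d) (θ : Misspec.Model E d) (hθ : θ ∈ q.models)
    (hconv : θ.DogmaticConvergence δ) (hrob : q.LocallyRobust δ α θ) :
    ∃ σ : A → ℝ, θ.IsBerkNash σ ∧ q.LocallyKLMinimizing θ σ := by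
  classical
  by_contra! hno
  obtain ⟨ε, hε, π₀, pol, hπ₀, hpol, hper⟩ := hrob
  have : Nonempty A := ⟨pol π₀⟩
  obtain ⟨b, hbsub, hbfin, hcover⟩ := θ.isCompact_berkNash.elim_finite_subcover_image
    (b := q.Ωq ∩ Metric.thickening ε (θ.params : Set (EuclideanSpace ℝ (Fin d))))
    (c := fun ω' => {σ | ∀ ω ∈ θ.params,
      Misspec.drift E (fun a => θ.dens a ω) (fun a => q.dens a ω') σ < 0})
    (fun ω' _ => by
      simp only [Set.ofPred_forall]
      exact θ.params.finite_toSet.isOpen_biInter fun ω _ =>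
        isOpen_lt Misspec.continuous_drift continuous_const)
    (fun σ hσ => by
      obtain ⟨ω', h1, h2⟩ := Misspec.Family.exists_better_of_not_locallyKLMinimizing hθ (hno σ hσ) hε
      exact Set.mem_biUnion h1 h2)
  set s := hbfin.toFinset
  have hsq : (↑s : Set (EuclideanSpace ℝ (Fin d))) ⊆ q.Ωq := fun ω hω =>
    (hbsub (hbfin.mem_toFinset.1 hω)).1
  set s' := θ.params ∪ s
  have hs'q : (↑s' : Set (EuclideanSpace ℝ (Fin d))) ⊆ q.Ωq := by
    rw [Finset.coe_union]
    exact Set.union_subset hθ.1 hsq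
  have hne : s'.Nonempty := θ.nonempty.mono Finset.subset_union_left
  obtain ⟨polc, hpolc⟩ := (q.model s' hne hs'q).exists_optimalPolicy hδ0 hδ1
  obtain ⟨πc, hπc, hdist⟩ := Misspec.exists_fullSupport_near θ (q.model s' hne hs'q)
    Finset.subset_union_left π₀ hε
  refine Misspec.not_persists_of_outperformed (s := s) (by linarith) hpol.1 (fun π hπ => ?_)
    Finset.subset_union_right hne hs'q hπ₀ hπc hpolc.1
    (hper _ ⟨q.model_mem_models _ _ _, ?_⟩ πc polc hπc hpolc hdist)
  · refine Misspec.ae_mem_outperformedSet hconv hpol hsq (fun σ hσ => ?_) hπ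
    obtain ⟨ω', h1, h2⟩ := Set.mem_iUnion₂.1 (hcover hσ)
    exact ⟨ω', hbfin.mem_toFinset.2 h1, h2⟩
  · refine Metric.hausdorffDist_le_of_mem_dist hε.le
      (fun ω hω => ⟨ω, Finset.mem_coe.2 (Finset.mem_union_left _ hω), by simpa using hε.le⟩)
      fun ω hω => ?_
    rcases Finset.mem_union.1 hω with h | h
    · exact ⟨ω, h, by simpa using hε.le⟩
    · obtain ⟨z, hz, hd⟩ := Metric.mem_thickening_iff.1 (hbsub (hbfin.mem_toFinset.1 h)).2
      exact ⟨z, hz, hd.le⟩
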